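/- Let $Q$ be a smooth manifold of finite dimension, $\tau:E\to Q$ a smooth real vector bundle of finite rank $m$ and $([\![\cdot,\cdot]\!],\rho)$ a Lie algebroid structure on $E$, with anchor $\rho:E\to TQ$ and differential of functions $d^Ef(a)=df(\rho(a))$. Let $\pi:E^*\times\mathbb R\to Q$ be the projection, and let $\mathcal T^E(E^*\times\mathbb R)\to E^*\times\mathbb R$ be the prolongation of $E$ over $\pi$: the vector bundle with fibre $\{(a,v)\in E_{\pi(p)}\times T_p(E^*\times\mathbb R):\rho(a)=T\pi(v)\}$ at $p$, with the Lie algebroid structure whose anchor is $(a,v)\mapsto v$ and whose bracket has the Lie bracket of vector fields as its second component and, for sections with first components $\sum_i f_i\,(\sigma_i\circ\pi)$ and $\sum_i g_i\,(\sigma_i\circ\pi)$ and second components $X_1$, $X_2$, the first component $\sum_{i,j}f_ig_j\,([\![\sigma_i,\sigma_j]\!]\circ\pi)+\sum_i(X_1(g_i)-X_2(f_i))\,(\sigma_i\circ\pi)$, where the $\sigma_i$ are sections of $E$ and the $f_i,g_i$ are smooth functions on $E^*\times\mathbb R$. Let $d$ be its exterior differential, let $\eta$ be its contact $1$-section $\eta_{(b,s)}(a,v)=ds(v)-b(a)$,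 and let $\mathcal R$ be its Reeb section, determined by $\imath_{\mathcal R}d\eta=0$, $\imath_{\mathcal R}\eta=1$. For a smooth function $H:E^*\times\mathbb R\to\mathbb R$ let $\xi_H$ be the Hamiltonian section, determined by $\imath_{\xi_H}\eta=-H$ and $\imath_{\xi_H}d\eta=dH-\mathcal R(H)\,\eta$, where $\mathcal R(H)=dH(\mathcal R)$, and let $\mathcal E_{v_H}=\xi_H+H\mathcal R$ be the evolution section. Let $\gamma$ be a smooth section of $\pi$, and let $F_\gamma=\{(a,T\gamma(\rho(a))):a\in E\}$, a vector bundle over $\gamma(Q)$ with the Lie algebroid structure carried over from $E$ by the isomorphism $a\mapsto(a,T\gamma(\rho(a)))$. Assume that $F_\gamma$, with its inclusion in $\mathcal T^E(E^*\times\mathbb R)$, is a Legendrian Lie subalgebroid: the inclusion is an injective Lie algebroid morphism over an injective immersion, the rank of $F_\gamma$ is $k$ where $2k+1$ is the rank of $\mathcal T^E(E^*\times\mathbb R)$, and $\eta$ vanishes on $F_\gamma$. Let $\mathcal E_{v_H}^\gamma=\mathrm{pr}_1\circ\mathcal E_{v_H}\circ\gamma$, a section of $E$. Then $\mathcal E_{v_H}$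 and $\mathcal E_{v_H}^\gamma$ are $\gamma$-related, that is, $\mathcal E_{v_H}\circ\gamma=(\mathrm{Id}_E,T\gamma\circ\rho)\circ\mathcal E_{v_H}^\gamma$, if and only if $d^E(H\circ\gamma)=0$ on $Q$. -/

import Mathlib

open Bundle Set Filter Topology
open scoped Manifold ContDiff Bundle

noncomputable section

/-! ### Exterior calculus of an algebroid -/

section Pre

/-- The derivative `v f` of a function `f` along the tangent vector `v` at `x`. -/
def dirDeriv {V H M : Type*} [NormedAddCommGroup V] [NormedSpace ℝ V] [TopologicalSpace H]
    (I : ModelWithCorners ℝ V H) [TopologicalSpace M] [ChartedSpace H M] (f : M → ℝ) (x : M) :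
    TangentSpace I x →ₗ[ℝ] ℝ :=
  (mfderiv I 𝓘(ℝ, ℝ) f x).toLinearMap

/-- The data that the exterior calculus of a Lie algebroid uses: a family of fibres over the
manifold `M`, the predicate that singles out the smooth sections, the anchor, and the bracket of
sections (meaningful on smooth sections only). The laws of a Lie algebroid are in `LieAlgebroid`;
this record is only ever used for a `LieAlgebroid` and for the prolongation built from it. -/
structure AlgebroidData {V H M : Type*} [NormedAddCommGroup V] [NormedSpace ℝ V]
    [TopologicalSpace H] (I : ModelWithCorners ℝ V H) [TopologicalSpace M] [ChartedSpace H M]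
    (A : M → Type*) [∀ x, AddCommGroup (A x)] [∀ x, Module ℝ (A x)] where
  IsSmooth : (∀ x, A x) → Prop
  anchor : ∀ x, A x →ₗ[ℝ] TangentSpace I x
  bracket : (∀ x, A x) → (∀ x, A x) → ∀ x, A x

namespace AlgebroidData

variable {V H M : Type*} [NormedAddCommGroup V] [NormedSpace ℝ V] [TopologicalSpace H]
  {I : ModelWithCorners ℝ V H} [TopologicalSpace M] [ChartedSpace H M]
  {A : M → Type*} [∀ x, AddCommGroup (A x)] [∀ x, Module ℝ (A x)]
  (𝒜 : AlgebroidData I A)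

/-- `d f`, the differential of a function: `(d f)(a) = ρ(a) f`. -/
def dFun (f : M → ℝ) (x : M) : A x →ₗ[ℝ] ℝ :=
  dirDeriv I f x ∘ₗ 𝒜.anchor x

/-- `k`-sections (sections of `⋀ᵏ A*`) that are smooth, tested on smooth sections. -/
def IsSmoothForm {k : ℕ} (θ : ∀ x, A x [⋀^Fin k]→ₗ[ℝ] ℝ) : Prop :=
  ∀ σ : Fin k → ∀ x, A x, (∀ i, 𝒜.IsSmooth (σ i)) →
    ContMDiff I 𝓘(ℝ, ℝ) ∞ fun x => θ x fun i => σ i x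

/-- The exterior differential evaluated on sections,
`(d θ)(σ₀, …, σₖ) = ∑ᵢ (-1)ⁱ ρ(σᵢ) θ(…, σ̂ᵢ, …) + ∑_{i<j} (-1)^{i+j} θ(⟦σᵢ, σⱼ⟧, …, σ̂ᵢ, …, σ̂ⱼ, …)`.

In the second sum the pair `i < j` is written as `i` together with the position `j - 1 ≥ i` of `σⱼ`
in the list without `σᵢ`, and the bracket is left at that position; moving it to the front costs
the sign `(-1)^{j-1}`, so that the sign here is `(-1)^{i+1}`. -/
def evalD {k : ℕ} (θ : ∀ x, A x [⋀^Fin k]→ₗ[ℝ] ℝ) (σ : Fin (k + 1) → ∀ x, A x) (x : M) : ℝ :=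
  (∑ i : Fin (k + 1), (-1 : ℝ) ^ (i : ℕ) *
    𝒜.dFun (fun y => θ y fun l => σ (i.succAbove l) y) x (σ i x)) +
  ∑ i : Fin (k + 1), ∑ j : Fin k,
    if (i : ℕ) ≤ (j : ℕ) then
      (-1 : ℝ) ^ ((i : ℕ) + 1) *
        θ x (Function.update (fun l => σ (i.succAbove l) x) j
          (𝒜.bracket (σ i) (σ (i.succAbove j)) x))
    else 0

/-- A smooth section with the value `a` at `x`. -/
def extend (x : M) (a : A x) : ∀ y, A y :=
  Classical.epsilon fun σ => 𝒜.IsSmooth σ ∧ σ x = a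

/-- The exterior differential at a point. By tensoriality the value does not depend on the smooth
sections through the given vectors. -/
def extDeriv {k : ℕ} (θ : ∀ x, A x [⋀^Fin k]→ₗ[ℝ] ℝ) (x : M) (v : Fin (k + 1) → A x) : ℝ :=
  𝒜.evalD θ (fun i => 𝒜.extend x (v i)) x

/-- A `1`-section as an alternating form of degree one. -/
def oneForm (η : ∀ x, A x →ₗ[ℝ] ℝ) (x : M) : A x [⋀^Fin 1]→ₗ[ℝ] ℝ :=
  AlternatingMap.ofSubsingleton ℝ (A x) ℝ (0 : Fin 1) (η x)

/-- `(d η)_x (a, b)` for a `1`-section `η`. -/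
def dOne (η : ∀ x, A x →ₗ[ℝ] ℝ) (x : M) (a b : A x) : ℝ :=
  𝒜.extDeriv (oneForm η) x ![a, b]

/-- The conditions `i_R dη = 0`, `i_R η = 1` on the Reeb section. They determine every value of `R`
for a contact `1`-section `η`. -/
def IsReeb (η : ∀ x, A x →ₗ[ℝ] ℝ) (R : ∀ x, A x) : Prop :=
  (∀ x b, 𝒜.dOne η x (R x) b = 0) ∧ ∀ x, η x (R x) = 1

/-- The Reeb section of a contact `1`-section `η`. -/
def reeb (η : ∀ x, A x →ₗ[ℝ] ℝ) : ∀ x, A x :=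
  Classical.epsilon (𝒜.IsReeb η)

/-- The conditions `i_ξ η = -H`, `i_ξ dη = dH - ρ(R)(H) η` on the Hamiltonian section. They
determine every value of `ξ` for a contact `1`-section `η`. -/
def IsHamiltonian (η : ∀ x, A x →ₗ[ℝ] ℝ) (h : M → ℝ) (ξ : ∀ x, A x) : Prop :=
  (∀ x, η x (ξ x) = -h x) ∧
    ∀ x b, 𝒜.dOne η x (ξ x) b = 𝒜.dFun h x b - 𝒜.dFun h x (𝒜.reeb η x) * η x b

/-- The Hamiltonian section `ξ_h` of a contact `1`-section `η`. -/
def hamiltonian (η : ∀ x, A x →ₗ[ℝ] ℝ) (h : M → ℝ) : ∀ x, A x :=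
  Classical.epsilon (𝒜.IsHamiltonian η h)

/-- The evolution section `ξ_h + h R`. -/
def evolution (η : ∀ x, A x →ₗ[ℝ] ℝ) (h : M → ℝ) (x : M) : A x :=
  𝒜.hamiltonian η h x + h x • 𝒜.reeb η x

variable {V' H' N : Type*} [NormedAddCommGroup V'] [NormedSpace ℝ V'] [TopologicalSpace H']
  {I' : ModelWithCorners ℝ V' H'} [TopologicalSpace N] [ChartedSpace H' N]
  {B : N → Type*} [∀ x, AddCommGroup (B x)] [∀ x, Module ℝ (B x)]

/-- The pull-back of a `k`-section along the bundle map `(j, i)`. -/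
def pullback {i : N → M} (j : ∀ x, B x →ₗ[ℝ] A (i x)) {k : ℕ}
    (θ : ∀ x, A x [⋀^Fin k]→ₗ[ℝ] ℝ) (x : N) : B x [⋀^Fin k]→ₗ[ℝ] ℝ :=
  (θ (i x)).compLinearMap (j x)

/-- `(j, i)`, with `j : B → A` over `i : N → M`, is a morphism of Lie algebroids: a smooth bundle
map such that `d ((j, i)* θ) = (j, i)* (d θ)` for every smooth `k`-section `θ` and every `k`. -/
structure IsMorphism (𝒜 : AlgebroidData I A) (ℬ : AlgebroidData I' B) (i : N → M)
    (j : ∀ x, B x →ₗ[ℝ] A (i x)) : Prop where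
  contMDiff : ContMDiff I' I ∞ i
  smooth_pullback : ∀ (k : ℕ) (θ : ∀ x, A x [⋀^Fin k]→ₗ[ℝ] ℝ), 𝒜.IsSmoothForm θ →
    ℬ.IsSmoothForm (pullback j θ)
  comm_d : ∀ (k : ℕ) (θ : ∀ x, A x [⋀^Fin k]→ₗ[ℝ] ℝ), 𝒜.IsSmoothForm θ →
    ∀ (x : N) (b : Fin (k + 1) → B x),
      ℬ.extDeriv (pullback j θ) x b = 𝒜.extDeriv θ (i x) fun l => j x (b l)

/-- A Lie subalgebroid: a morphism `(j, i)` with `j` injective on fibres and `i` an injective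
immersion. -/
structure IsSubalgebroid (𝒜 : AlgebroidData I A) (ℬ : AlgebroidData I' B) (i : N → M)
    (j : ∀ x, B x →ₗ[ℝ] A (i x)) : Prop extends IsMorphism 𝒜 ℬ i j where
  injective_fibre : ∀ x, Function.Injective (j x)
  injective_base : Function.Injective i
  immersion : ∀ x, Function.Injective (mfderiv I' I i x)

/-- A Legendrian Lie subalgebroid with respect to the contact `1`-section `η`: the ambient rank is
`2k + 1`, the rank of the subalgebroid is `k`, and `η` vanishes on it. -/
structure IsLegendrian (𝒜 : AlgebroidData I A) (η : ∀ x, A x →ₗ[ℝ] ℝ) (ℬ : AlgebroidData I' B)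
    (i : N → M) (j : ∀ x, B x →ₗ[ℝ] A (i x)) : Prop extends IsSubalgebroid 𝒜 ℬ i j where
  rank : ∃ k : ℕ, (∀ y, Module.finrank ℝ (A y) = 2 * k + 1) ∧ ∀ x, Module.finrank ℝ (B x) = k
  vanishes : ∀ (x : N) (b : B x), η (i x) (j x b) = 0

end AlgebroidData

end Pre

/-! ### Lie algebroids and their prolongations -/

section Algebroid

variable {V F Q : Type*} [NormedAddCommGroup V] [NormedSpace ℝ V]
  [NormedAddCommGroup F] [NormedSpace ℝ F]
  [TopologicalSpace Q] [ChartedSpace V Q] [IsManifold 𝓘(ℝ, V) ∞ Q]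
  {E : Q → Type*} [∀ q, AddCommGroup (E q)] [∀ q, Module ℝ (E q)] [∀ q, TopologicalSpace (E q)]
  [TopologicalSpace (TotalSpace F E)] [FiberBundle F E]

variable (V F) in
/-- Smooth sections of the vector bundle `E`. -/
def SmoothSection (σ : ∀ q, E q) : Prop :=
  ContMDiff 𝓘(ℝ, V) (𝓘(ℝ, V).prod 𝓘(ℝ, F)) ∞ fun q => TotalSpace.mk' F q (σ q)

variable (V F E) in
/-- A Lie algebroid structure on the vector bundle `E → Q`: a smooth bundle map `ρ : E → TQ` over
the identity and a Lie bracket on the smooth sections with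
`⟦σ, f τ⟧ = f ⟦σ, τ⟧ + (ρ(σ) f) τ`. (The bracket of sections that are not both smooth is never
used.) -/
structure LieAlgebroid where
  anchor : ∀ q, E q →ₗ[ℝ] TangentSpace 𝓘(ℝ, V) q
  contMDiff_anchor : ContMDiff (𝓘(ℝ, V).prod 𝓘(ℝ, F)) 𝓘(ℝ, V).tangent ∞
    fun a : TotalSpace F E => (⟨a.proj, anchor a.proj a.2⟩ : TangentBundle 𝓘(ℝ, V) Q)
  bracket : (∀ q, E q) → (∀ q, E q) → ∀ q, E q
  smooth_bracket : ∀ σ τ, SmoothSection V F σ → SmoothSection V F τ →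
    SmoothSection V F (bracket σ τ)
  bracket_add : ∀ σ τ υ, SmoothSection V F σ → SmoothSection V F τ → SmoothSection V F υ →
    bracket σ (τ + υ) = bracket σ τ + bracket σ υ
  bracket_smul : ∀ (c : ℝ) (σ τ : ∀ q, E q), SmoothSection V F σ → SmoothSection V F τ →
    bracket σ (c • τ) = c • bracket σ τ
  bracket_antisymm : ∀ σ τ, SmoothSection V F σ → SmoothSection V F τ →
    bracket σ τ = -bracket τ σ
  jacobi : ∀ σ τ υ, SmoothSection V F σ → SmoothSection V F τ → SmoothSection V F υ →
    bracket σ (bracket τ υ) + bracket τ (bracket υ σ) + bracket υ (bracket σ τ) = 0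
  leibniz : ∀ (f : Q → ℝ) (σ τ : ∀ q, E q), ContMDiff 𝓘(ℝ, V) 𝓘(ℝ, ℝ) ∞ f →
    SmoothSection V F σ → SmoothSection V F τ → ∀ q,
      bracket σ (fun q => f q • τ q) q =
        f q • bracket σ τ q + dirDeriv 𝓘(ℝ, V) f q (anchor q (σ q)) • τ q

namespace LieAlgebroid

variable (𝓔 : LieAlgebroid V F E)

/-- The data of the exterior calculus of `E`. -/
def data : AlgebroidData 𝓘(ℝ, V) E where
  IsSmooth := SmoothSection V F
  anchor := 𝓔.anchor
  bracket := 𝓔.bracket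

section Prolongation

variable {W K P : Type*} [NormedAddCommGroup W] [NormedSpace ℝ W] [TopologicalSpace K]
  (J : ModelWithCorners ℝ W K) [TopologicalSpace P] [ChartedSpace K P]
  [IsManifold J ∞ P] (pr : P → Q)

/-- The fibre at `p` of the prolongation of `E` over `pr : P → Q`:
the pairs `(a, v)` in `E_{pr p} × T_p P` with `ρ(a) = Tpr(v)`. -/
def Prol (p : P) : Submodule ℝ (E (pr p) × TangentSpace J p) :=
  LinearMap.eqLocus
    (𝓔.anchor (pr p) ∘ₗ LinearMap.fst ℝ (E (pr p)) (TangentSpace J p))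
    ((mfderiv J 𝓘(ℝ, V) pr p).toLinearMap ∘ₗ LinearMap.snd ℝ (E (pr p)) (TangentSpace J p))

variable {J pr} in
/-- Smooth sections of the prolongation: both components are smooth. -/
def ProlSmooth (Z : ∀ p, 𝓔.Prol J pr p) : Prop :=
  ContMDiff J (𝓘(ℝ, V).prod 𝓘(ℝ, F)) ∞ (fun p => TotalSpace.mk' F (pr p) (Z p).1.1) ∧
    ContMDiff J J.tangent ∞ fun p => (⟨p, (Z p).1.2⟩ : TangentBundle J P)

variable {J pr} in
/-- `w` is the value at `p` of the bracket of the sections `Z₁ = (a₁, X₁)` and `Z₂ = (a₂, X₂)`.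
Its second component is `[X₁, X₂]`. Whenever `a₁ = ∑ fᵢ (σᵢ ∘ pr)` and `a₂ = ∑ gᵢ (σᵢ ∘ pr)` near
`p` for smooth sections `σᵢ` of `E` and smooth functions `fᵢ`, `gᵢ` on `P`, the first component is
`∑ᵢⱼ fᵢ gⱼ (⟦σᵢ, σⱼ⟧ ∘ pr) + ∑ᵢ (X₁ gᵢ - X₂ fᵢ) (σᵢ ∘ pr)`. -/
def IsProlBracket (Z₁ Z₂ : ∀ p, 𝓔.Prol J pr p) (p : P) (w : 𝓔.Prol J pr p) : Prop :=
  w.1.2 = VectorField.mlieBracket J (fun p => (Z₁ p).1.2) (fun p => (Z₂ p).1.2) p ∧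
  ∀ (r : ℕ) (σ : Fin r → ∀ q, E q) (f g : Fin r → P → ℝ),
    (∀ i, SmoothSection V F (σ i)) →
    (∀ i, ContMDiff J 𝓘(ℝ, ℝ) ∞ (f i)) → (∀ i, ContMDiff J 𝓘(ℝ, ℝ) ∞ (g i)) →
    (∀ᶠ y in 𝓝 p, (Z₁ y).1.1 = ∑ i, f i y • σ i (pr y)) →
    (∀ᶠ y in 𝓝 p, (Z₂ y).1.1 = ∑ i, g i y • σ i (pr y)) →
    w.1.1 = ∑ i, ∑ j, (f i p * g j p) • 𝓔.bracket (σ i) (σ j) (pr p) +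
      ∑ i, (dirDeriv J (g i) p (Z₁ p).1.2 - dirDeriv J (f i) p (Z₂ p).1.2) • σ i (pr p)

/-- The prolongation `𝒯ᴱP`, with anchor `(a, v) ↦ v`. -/
def prolongation : AlgebroidData J (fun p => 𝓔.Prol J pr p) where
  IsSmooth := 𝓔.ProlSmooth
  anchor p := LinearMap.snd ℝ (E (pr p)) (TangentSpace J p) ∘ₗ (𝓔.Prol J pr p).subtype
  bracket Z₁ Z₂ p := Classical.epsilon (𝓔.IsProlBracket Z₁ Z₂ p)

end Prolongation

end LieAlgebroid

end Algebroid

/-! ### The contact structure on the prolongation over `E* × ℝ` -/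

section Contact

variable {V F Q : Type*} [NormedAddCommGroup V] [NormedSpace ℝ V]
  [NormedAddCommGroup F] [NormedSpace ℝ F]
  [TopologicalSpace Q] [ChartedSpace V Q] [IsManifold 𝓘(ℝ, V) ∞ Q]
  {E : Q → Type*} [∀ q, AddCommGroup (E q)] [∀ q, Module ℝ (E q)] [∀ q, TopologicalSpace (E q)]
  [TopologicalSpace (TotalSpace F E)] [FiberBundle F E] [VectorBundle ℝ F E]
  [ContMDiffVectorBundle ∞ F E 𝓘(ℝ, V)]

variable (F E) in
/-- The manifold `E* × ℝ`; a point is `(⟨q, b⟩, s)` with `b` a linear form on `E q`. -/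
abbrev PhaseSpace : Type _ :=
  TotalSpace (F →L[ℝ] ℝ) (fun q : Q => E q →L[ℝ] Bundle.Trivial Q ℝ q) × ℝ

variable (V F) in
/-- The model of `E* × ℝ`. -/
abbrev phaseModel :=
  (𝓘(ℝ, V).prod 𝓘(ℝ, F →L[ℝ] ℝ)).prod 𝓘(ℝ, ℝ)

variable (F E) in
/-- The projection `E* × ℝ → Q`. -/
def phaseProj (p : PhaseSpace F E) : Q := p.1.proj

variable (V F E) in
/-- A smooth section `γ = (γ₀, γ_s)` of `E* × ℝ → Q`. -/
structure PhaseSection where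
  form : ∀ q, E q →L[ℝ] Bundle.Trivial Q ℝ q
  fn : Q → ℝ
  smooth : ContMDiff 𝓘(ℝ, V) (phaseModel V F) ∞
    fun q => ((⟨q, form q⟩, fn q) : PhaseSpace F E)

/-- The map `γ : Q → E* × ℝ`. -/
def PhaseSection.map (γ : PhaseSection V F E) (q : Q) : PhaseSpace F E := (⟨q, γ.form q⟩, γ.fn q)

namespace LieAlgebroid

variable (𝓔 : LieAlgebroid V F E)

/-- The contact Hamiltonian prolongation `𝒯ᴱ(E* × ℝ)`. -/
abbrev contactProl :=
  𝓔.prolongation (phaseModel V F) (phaseProj F E)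

/-- The contact `1`-section `η = 𝒱ˢ - Θ`, that is, `η_{(b, s)}(a, v) = ds(v) - b(a)`. -/
def contactForm (p : PhaseSpace F E) : 𝓔.Prol (phaseModel V F) (phaseProj F E) p →ₗ[ℝ] ℝ :=
  (dirDeriv (phaseModel V F) (Prod.snd : PhaseSpace F E → ℝ) p ∘ₗ
      LinearMap.snd ℝ (E p.1.proj) (TangentSpace (phaseModel V F) p) -
    (p.1.2.toLinearMap : E p.1.proj →ₗ[ℝ] ℝ) ∘ₗ
      LinearMap.fst ℝ (E p.1.proj) (TangentSpace (phaseModel V F) p)) ∘ₗ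
  (𝓔.Prol (phaseModel V F) (phaseProj F E) p).subtype

theorem mfderiv_phaseProj_section (γ : PhaseSection V F E) (q : Q) (v : TangentSpace 𝓘(ℝ, V) q) :
    mfderiv (phaseModel V F) 𝓘(ℝ, V) (phaseProj F E) (γ.map q)
      (mfderiv 𝓘(ℝ, V) (phaseModel V F) γ.map q v) = v := by
  have h1 : MDifferentiableAt 𝓘(ℝ, V) (phaseModel V F) γ.map q :=
    (γ.smooth.mdifferentiable (by simp)) q
  have h2 : MDifferentiableAt (phaseModel V F) 𝓘(ℝ, V) (phaseProj F E) (γ.map q) :=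
    ((Bundle.contMDiff_proj (n := ∞) (F := F →L[ℝ] ℝ) (IB := 𝓘(ℝ, V))
      (fun q : Q => E q →L[ℝ] Bundle.Trivial Q ℝ q)).comp contMDiff_fst).mdifferentiable
        (by simp) (γ.map q)
  have h3 := mfderiv_comp q h2 h1
  have h4 : phaseProj F E ∘ γ.map = id := rfl
  rw [h4, mfderiv_id] at h3
  exact (congrArg (fun L => L v) h3).symm

/-- The bundle map `(Id_E, Tγ ∘ ρ) : E → 𝒯ᴱ(E* × ℝ)` over `γ`, `a ↦ (a, Tγ(ρ(a)))`. Its image is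
the vector bundle `F_γ` over `γ(Q)`; it is a vector bundle isomorphism of `E` with `F_γ`, through
which `F_γ` carries its Lie algebroid structure. -/
def graphMap (γ : PhaseSection V F E) (q : Q) :
    E q →ₗ[ℝ] 𝓔.Prol (phaseModel V F) (phaseProj F E) (γ.map q) :=
  LinearMap.codRestrict (𝓔.Prol (phaseModel V F) (phaseProj F E) (γ.map q))
    (LinearMap.prod LinearMap.id
      ((mfderiv 𝓘(ℝ, V) (phaseModel V F) γ.map q).toLinearMap ∘ₗ 𝓔.anchor q))
    fun a => (mfderiv_phaseProj_section γ q (𝓔.anchor q a)).symm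

/-- The section `γ` is Legendrian: `F_γ → γ(Q)`, with its inclusion in `𝒯ᴱ(E* × ℝ)`, is a
Legendrian Lie subalgebroid for the contact `1`-section `η`. -/
def IsLegendrianSection (γ : PhaseSection V F E) : Prop :=
  AlgebroidData.IsLegendrian 𝓔.contactProl 𝓔.contactForm 𝓔.data γ.map (𝓔.graphMap γ)

/-- The evolution section `ℰ_H = ξ_H + H R` of `𝒯ᴱ(E* × ℝ)`. -/
def evolutionSection (H : PhaseSpace F E → ℝ) (p : PhaseSpace F E) :
    𝓔.Prol (phaseModel V F) (phaseProj F E) p :=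
  𝓔.contactProl.evolution 𝓔.contactForm H p

/-- The section `Z^γ = pr₁ ∘ Z ∘ γ` of `E` induced by a section `Z` of `𝒯ᴱ(E* × ℝ)`. -/
def inducedSection (γ : PhaseSection V F E)
    (Z : ∀ p, 𝓔.Prol (phaseModel V F) (phaseProj F E) p) (q : Q) : E q :=
  (Z (γ.map q)).1.1

/-- A section `Z` of `𝒯ᴱ(E* × ℝ)` and a section `σ` of `E` are `γ`-related:
`Z ∘ γ = (Id_E, Tγ ∘ ρ) ∘ σ`. -/
def GammaRelated (γ : PhaseSection V F E)
    (Z : ∀ p, 𝓔.Prol (phaseModel V F) (phaseProj F E) p) (σ : ∀ q, E q) : Prop :=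
  ∀ q, Z (γ.map q) = 𝓔.graphMap γ q (σ q)

end LieAlgebroid

end Contact

end

/-! Write Z for the evolution section ξ_H + HR. The defining conditions give η(Z) = -H + H = 0.
Since R lies in the kernel of dη, they also give dη(Z, w) = dH(w) whenever η(w) = 0
(`contactForm_evolutionSection`, `dOne_evolutionSection`). The form η vanishes on F_γ and the
inclusion of F_γ commutes with d, so dη vanishes on F_γ as well (`dOne_graphMap`). For w = (a,
Tγ(ρ(a))) the chain rule turns dH(w) into d^E(H ∘ γ)(a), hence dη(Z, w) = d^E(H ∘ γ)(a) along γ. If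
Z ∘ γ takes values in F_γ, the left side is zero. Conversely, if the right side is zero, Z ∘ γ lies
in ker η and is dη-orthogonal to F_γ, and so is its difference from the element of F_γ with the same
first component. On vectors of ker η with first component 0, dη is a perfect pairing with first
components, and F_γ projects onto E; the difference is therefore zero (`eq_graphMap`).

The pairing is read off from `dOne_contactForm`: if c_k are the coordinates of the first component
in a local frame σ_k of E and μ_k is the momentum of σ_k, then dη is ∑ c_k ∧ dμ_k plus a bilinear
form in the c_k alone. The same formula yields the Reeb and Hamiltonian sections pointwise.

Most of the work goes into that formula. The bracket of the prolongation is a choice, so a vector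
with the required properties must be exhibited: its first component must not depend on the chosen
representation (`prolFst_eq_frame`), and the pair must lie in the prolongation (`anchor_prolFst`).
The latter rests on the anchor respecting brackets, a consequence of Jacobi and Leibniz
(`act_bracket`). Vectors must also extend to smooth sections (`exists_prolSmooth`), since d is
evaluated on chosen extensions. -/

set_option linter.unusedSectionVars false

noncomputable section

/-! ### Derivatives of functions along tangent vectors and vector fields -/

section DirDeriv

variable {V H M : Type*} [NormedAddCommGroup V] [NormedSpace ℝ V] [TopologicalSpace H]
  {I : ModelWithCorners ℝ V H} [TopologicalSpace M] [ChartedSpace H M]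
  {f g : M → ℝ} {x : M}

theorem Filter.EventuallyEq.dirDeriv_eq (h : f =ᶠ[𝓝 x] g) : dirDeriv I f x = dirDeriv I g x := by
  unfold dirDeriv
  rw [h.mfderiv_eq]

theorem dirDeriv_add (hf : MDifferentiableAt I 𝓘(ℝ, ℝ) f x)
    (hg : MDifferentiableAt I 𝓘(ℝ, ℝ) g x) (v : TangentSpace I x) :
    dirDeriv I (fun y => f y + g y) x v = dirDeriv I f x v + dirDeriv I g x v :=
  congrArg (fun L => L v) (mfderiv_add hf hg)

theorem dirDeriv_sub (hf : MDifferentiableAt I 𝓘(ℝ, ℝ) f x)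
    (hg : MDifferentiableAt I 𝓘(ℝ, ℝ) g x) (v : TangentSpace I x) :
    dirDeriv I (fun y => f y - g y) x v = dirDeriv I f x v - dirDeriv I g x v :=
  congrArg (fun L => L v) (mfderiv_sub hf hg)

theorem dirDeriv_mul (hf : MDifferentiableAt I 𝓘(ℝ, ℝ) f x)
    (hg : MDifferentiableAt I 𝓘(ℝ, ℝ) g x) (v : TangentSpace I x) :
    dirDeriv I (fun y => f y * g y) x v = f x * dirDeriv I g x v + g x * dirDeriv I f x v :=
  congrArg (fun L => L v) (hf.hasMFDerivAt.mul hg.hasMFDerivAt).mfderiv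

@[simp]
theorem dirDeriv_const (c : ℝ) : dirDeriv I (fun _ : M => c) x = 0 := by
  unfold dirDeriv
  rw [mfderiv_const]
  rfl

theorem MDifferentiableAt.fun_sum_real {ι : Type*} (s : Finset ι) {f : ι → M → ℝ}
    (hf : ∀ i ∈ s, MDifferentiableAt I 𝓘(ℝ, ℝ) (f i) x) :
    MDifferentiableAt I 𝓘(ℝ, ℝ) (fun y => ∑ i ∈ s, f i y) x := by
  classical
  induction s using Finset.induction_on with
  | empty => simpa using mdifferentiableAt_const
  | insert a s ha ih =>
    simp only [Finset.sum_insert ha]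
    exact (hf a (by simp)).add (ih fun i hi => hf i (by simp [hi]))

theorem dirDeriv_sum {ι : Type*} (s : Finset ι) {f : ι → M → ℝ}
    (hf : ∀ i ∈ s, MDifferentiableAt I 𝓘(ℝ, ℝ) (f i) x) (v : TangentSpace I x) :
    dirDeriv I (fun y => ∑ i ∈ s, f i y) x v = ∑ i ∈ s, dirDeriv I (f i) x v := by
  classical
  induction s using Finset.induction_on with
  | empty => simp
  | insert a s ha ih =>
    simp only [Finset.sum_insert ha]
    rw [dirDeriv_add (hf a (by simp))
      (MDifferentiableAt.fun_sum_real s fun i hi => hf i (by simp [hi])),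
      ih fun i hi => hf i (by simp [hi])]

theorem MDifferentiableAt.fun_mul_real (hf : MDifferentiableAt I 𝓘(ℝ, ℝ) f x)
    (hg : MDifferentiableAt I 𝓘(ℝ, ℝ) g x) :
    MDifferentiableAt I 𝓘(ℝ, ℝ) (fun y => f y * g y) x :=
  hf.mul hg

theorem dirDeriv_sum_mul {ι : Type*} (s : Finset ι) {f g : ι → M → ℝ}
    (hf : ∀ i, MDifferentiableAt I 𝓘(ℝ, ℝ) (f i) x)
    (hg : ∀ i, MDifferentiableAt I 𝓘(ℝ, ℝ) (g i) x) (v : TangentSpace I x) :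
    dirDeriv I (fun y => ∑ i ∈ s, f i y * g i y) x v =
      ∑ i ∈ s, (f i x * dirDeriv I (g i) x v + g i x * dirDeriv I (f i) x v) := by
  rw [dirDeriv_sum s fun i _ => (hf i).fun_mul_real (hg i)]
  exact Finset.sum_congr rfl fun i _ => dirDeriv_mul (hf i) (hg i) v

theorem dirDeriv_comp {V' H' N : Type*} [NormedAddCommGroup V'] [NormedSpace ℝ V']
    [TopologicalSpace H'] {I' : ModelWithCorners ℝ V' H'} [TopologicalSpace N] [ChartedSpace H' N]
    {φ : N → M} {y : N} (hf : MDifferentiableAt I 𝓘(ℝ, ℝ) f (φ y))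
    (hφ : MDifferentiableAt I' I φ y) (v : TangentSpace I' y) :
    dirDeriv I' (fun y => f (φ y)) y v = dirDeriv I f (φ y) (mfderiv I' I φ y v) :=
  congrArg (fun L => L v) (mfderiv_comp y hf hφ)

theorem ContMDiff.dirDeriv_apply [IsManifold I ∞ M] {f : M → ℝ} (hf : ContMDiff I 𝓘(ℝ, ℝ) ∞ f)
    {X : ∀ x, TangentSpace I x}
    (hX : ContMDiff I I.tangent ∞ fun x => (⟨x, X x⟩ : TangentBundle I M)) :
    ContMDiff I 𝓘(ℝ, ℝ) ∞ fun x => dirDeriv I f x (X x) :=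
  (contMDiff_snd_tangentBundle_modelSpace ℝ 𝓘(ℝ, ℝ)).comp
    ((hf.contMDiff_tangentMap (m := ∞) (by simp)).comp hX)

/-- Linear functionals of a chart, cut off by a bump function, are global smooth functions and
already separate tangent vectors. -/
theorem eq_of_forall_dirDeriv_eq [FiniteDimensional ℝ V] [IsManifold I ∞ M] [T2Space M]
    {v w : TangentSpace I x}
    (h : ∀ f : M → ℝ, ContMDiff I 𝓘(ℝ, ℝ) ∞ f → dirDeriv I f x v = dirDeriv I f x w) :
    v = w := by
  have hinj : Function.Injective (mfderiv I 𝓘(ℝ, V) (extChartAt I x) x) :=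
    ContinuousLinearMap.IsInvertible.injective
      (isInvertible_mfderiv_extChartAt (mem_extChartAt_source x))
  apply hinj
  by_contra hne
  obtain ⟨l, hl⟩ := SeparatingDual.exists_separating_of_ne (R := ℝ) (V := V) hne
  apply hl
  obtain ⟨χ⟩ : Nonempty (SmoothBumpFunction I x) := inferInstance
  have hd : MDifferentiableAt I 𝓘(ℝ, V) (extChartAt I x) x :=
    mdifferentiableAt_extChartAt (mem_chart_source H x)
  have key : ∀ u : TangentSpace I x,
      dirDeriv I (fun y => χ y • l (extChartAt I x y)) x u =
        l (mfderiv I 𝓘(ℝ, V) (extChartAt I x) x u) := by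
    intro u
    have h1 : (fun y => χ y • l (extChartAt I x y)) =ᶠ[𝓝 x] fun y => l (extChartAt I x y) := by
      filter_upwards [χ.eventuallyEq_one] with y hy
      simp [hy]
    rw [h1.dirDeriv_eq]
    have h2 := mfderiv_comp x (I'' := 𝓘(ℝ, ℝ)) l.differentiableAt.mdifferentiableAt hd
    have h3 : mfderiv I 𝓘(ℝ, ℝ) (l ∘ extChartAt I x) x u
      = (mfderiv 𝓘(ℝ, V) 𝓘(ℝ, ℝ) l (extChartAt I x x)).comp
          (mfderiv I 𝓘(ℝ, V) (extChartAt I x) x) u := congrArg (fun L => L u) h2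
    refine h3.trans ?_
    rw [mfderiv_eq_fderiv, ContinuousLinearMap.fderiv]
    rfl
  rw [← key v, ← key w]
  refine h _ (χ.contMDiff_smul fun y hy => ?_)
  exact (l.contDiff.contMDiff.contMDiffAt.comp y
    (contMDiffAt_extChartAt' hy)).contMDiffWithinAt

theorem fderiv_comp_extChartAt_symm_mpullbackWithin [I.Boundaryless] [IsManifold I ∞ M]
    {X : ∀ x, TangentSpace I x} {z : V} (hz : z ∈ (extChartAt I x).target)
    (hf : MDifferentiableAt I 𝓘(ℝ, ℝ) f ((extChartAt I x).symm z)) :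
    fderiv ℝ (f ∘ (extChartAt I x).symm) z
        (VectorField.mpullbackWithin 𝓘(ℝ, V) I (extChartAt I x).symm X (range I) z) =
      dirDeriv I f ((extChartAt I x).symm z) (X ((extChartAt I x).symm z)) := by
  have : IsManifold I 1 M := IsManifold.of_le (n := ∞) (by simp)
  have hinv := isInvertible_mfderivWithin_extChartAt_symm (I := I) hz
  have hd : MDifferentiableAt 𝓘(ℝ, V) I (extChartAt I x).symm z := by
    have := mdifferentiableWithinAt_extChartAt_symm (I := I) hz
    rwa [I.range_eq_univ, mdifferentiableWithinAt_univ] at this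
  have h1 := mfderiv_comp z hf hd
  rw [VectorField.mpullbackWithin_apply]
  rw [I.range_eq_univ, mfderivWithin_univ] at hinv ⊢
  obtain ⟨L, hL⟩ := hinv
  have h2 : mfderiv 𝓘(ℝ, V) I (extChartAt I x).symm z
      ((mfderiv 𝓘(ℝ, V) I (extChartAt I x).symm z).inverse
        (X ((extChartAt I x).symm z))) = X ((extChartAt I x).symm z) := by
    rw [← hL, ContinuousLinearMap.inverse_equiv]
    exact L.apply_symm_apply _
  rw [← mfderiv_eq_fderiv]
  refine (congrArg (fun T => T ((mfderiv 𝓘(ℝ, V) I (extChartAt I x).symm z).inverse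
        (X ((extChartAt I x).symm z)))) h1).trans ?_
  exact congrArg (dirDeriv I f ((extChartAt I x).symm z)) h2

theorem two_le_infty : (2 : WithTop ℕ∞) ≤ ∞ :=
  WithTop.coe_le_coe.2 (le_top : (2 : ℕ∞) ≤ ⊤)

/-- The manifold bracket is the chart pull-back of the vector space bracket, so the identity is
transported from its vector space version in the chart at `x`. -/
theorem dirDeriv_mlieBracket [CompleteSpace V] [I.Boundaryless] [IsManifold I ∞ M]
    (hf : ContMDiff I 𝓘(ℝ, ℝ) ∞ f) {X Y : ∀ x, TangentSpace I x}
    (hX : ContMDiff I I.tangent ∞ fun x => (⟨x, X x⟩ : TangentBundle I M))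
    (hY : ContMDiff I I.tangent ∞ fun x => (⟨x, Y x⟩ : TangentBundle I M)) (x : M) :
    dirDeriv I f x (VectorField.mlieBracket I X Y x) =
      dirDeriv I (fun y => dirDeriv I f y (Y y)) x (X x) -
        dirDeriv I (fun y => dirDeriv I f y (X y)) x (Y x) := by
  have : IsManifold I 1 M := IsManifold.of_le (n := ∞) (by simp)
  have : IsManifold I 2 M := IsManifold.of_le (n := ∞) two_le_infty
  set φ := extChartAt I x with hφ
  have hx : φ x ∈ φ.target := mem_extChartAt_target x
  have htgt : φ.target ∈ 𝓝 (φ x) := extChartAt_target_mem_nhds x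
  -- Without boundary the range of the model is everything, so derivatives within it are ordinary
  -- derivatives.
  have huniv : φ.symm ⁻¹' univ ∩ range I = univ := by simp [I.range_eq_univ]
  have hY' := hf.dirDeriv_apply hY
  have hX' := hf.dirDeriv_apply hX
  have hdiff : ∀ {Z : ∀ x, TangentSpace I x},
      ContMDiff I I.tangent ∞ (fun x => (⟨x, Z x⟩ : TangentBundle I M)) →
      DifferentiableAt ℝ (VectorField.mpullbackWithin 𝓘(ℝ, V) I φ.symm Z (range I)) (φ x) := by
    intro Z hZ
    have h := (hZ.mdifferentiable (by simp) x).mdifferentiableWithinAt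
      (s := univ) |>.differentiableWithinAt_mpullbackWithin_vectorField
    rw [huniv] at h
    exact differentiableWithinAt_univ.1 h
  have hg : ContDiffAt ℝ ∞ (f ∘ φ.symm) (φ x) := by
    rw [← contMDiffAt_iff_contDiffAt]
    exact hf.contMDiffAt.comp _ ((contMDiffOn_extChartAt_symm x).contMDiffAt htgt)
  have key := VectorField.fderiv_apply_lieBracket hg
    (by simpa using two_le_infty) (hdiff hY) (hdiff hX)
  have hcongr : ∀ Z : ∀ x, TangentSpace I x,
      (fun z => fderiv ℝ (f ∘ φ.symm) z
        (VectorField.mpullbackWithin 𝓘(ℝ, V) I φ.symm Z (range I) z)) =ᶠ[𝓝 (φ x)]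
      (fun y => dirDeriv I f y (Z y)) ∘ φ.symm := by
    intro Z
    filter_upwards [htgt] with z hz
    exact fderiv_comp_extChartAt_symm_mpullbackWithin hz (hf.mdifferentiable (by simp) _)
  rw [(hcongr X).fderiv_eq, (hcongr Y).fderiv_eq,
    fderiv_comp_extChartAt_symm_mpullbackWithin hx (hY'.mdifferentiable (by simp) _),
    fderiv_comp_extChartAt_symm_mpullbackWithin hx (hX'.mdifferentiable (by simp) _),
    extChartAt_to_inv] at key
  rw [← key]
  have hinv := isInvertible_mfderiv_extChartAt (I := I) (mem_extChartAt_source (I := I) x)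
  have hd : MDifferentiableAt 𝓘(ℝ, V) 𝓘(ℝ, ℝ) (f ∘ φ.symm) (φ x) :=
    (hg.differentiableAt (by simp)).mdifferentiableAt
  have hφd : MDifferentiableAt I 𝓘(ℝ, V) φ x := mdifferentiableAt_extChartAt (mem_chart_source H x)
  have h1 : f =ᶠ[𝓝 x] (f ∘ φ.symm) ∘ φ := by
    filter_upwards [extChartAt_source_mem_nhds (I := I) x] with y hy
    exact congrArg f ((extChartAt I x).left_inv hy).symm
  let A : V → V := VectorField.mpullbackWithin 𝓘(ℝ, V) I φ.symm X (range I)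
  let B : V → V := VectorField.mpullbackWithin 𝓘(ℝ, V) I φ.symm Y (range I)
  have hb : VectorField.mlieBracket I X Y x =
      (mfderiv I 𝓘(ℝ, V) φ x).inverse
        (show V from VectorField.lieBracket ℝ A B (φ x)) := by
    have h2 : VectorField.lieBracketWithin ℝ A B (φ.symm ⁻¹' univ ∩ range I) (φ x) =
        VectorField.lieBracket ℝ A B (φ x) := by
      rw [huniv, VectorField.lieBracketWithin_univ]
    exact VectorField.mlieBracketWithin_apply.trans
      (congrArg (mfderiv I 𝓘(ℝ, V) φ x).inverse h2)
  obtain ⟨L, hL⟩ := hinv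
  rw [h1.dirDeriv_eq, hb]
  refine (dirDeriv_comp hd hφd _).trans ?_
  rw [← hL, ContinuousLinearMap.inverse_equiv]
  unfold dirDeriv
  rw [mfderiv_eq_fderiv]
  exact congrArg (fderiv ℝ (f ∘ φ.symm) (φ x)) (L.apply_symm_apply _)

end DirDeriv

/-! ### Cut-off functions and local frames -/

theorem ContMDiffOn.mul_comp_of_tsupport {V Q W K P : Type*} [NormedAddCommGroup V] [NormedSpace ℝ V]
    [TopologicalSpace Q] [ChartedSpace V Q] [NormedAddCommGroup W] [NormedSpace ℝ W]
    [TopologicalSpace K] {J : ModelWithCorners ℝ W K} [TopologicalSpace P] [ChartedSpace K P]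
    {pr : P → Q} (hpr : ContMDiff J 𝓘(ℝ, V) ∞ pr) {χ : Q → ℝ}
    (hχ : ContMDiff 𝓘(ℝ, V) 𝓘(ℝ, ℝ) ∞ χ) {U : Set Q} (hU : IsOpen U) (hs : tsupport χ ⊆ U)
    {g : P → ℝ} (hg : ContMDiffOn J 𝓘(ℝ, ℝ) ∞ g (pr ⁻¹' U)) :
    ContMDiff J 𝓘(ℝ, ℝ) ∞ fun p => χ (pr p) * g p := by
  refine contMDiff_of_tsupport fun p hp => ?_
  have h1 : pr p ∈ tsupport χ := by
    have h2 : tsupport (fun p => χ (pr p) * g p) ⊆ pr ⁻¹' tsupport χ :=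
      closure_minimal (fun y hy => subset_tsupport _ (left_ne_zero_of_mul hy))
        ((isClosed_tsupport χ).preimage hpr.continuous)
    exact h2 hp
  exact (hχ.comp hpr).contMDiffAt.mul
    (hg.contMDiffAt ((hU.preimage hpr.continuous).mem_nhds (hs h1)))

section Frame

variable {V F Q : Type*} [NormedAddCommGroup V] [NormedSpace ℝ V] [FiniteDimensional ℝ V]
  [NormedAddCommGroup F] [NormedSpace ℝ F] [FiniteDimensional ℝ F]
  [TopologicalSpace Q] [T2Space Q] [ChartedSpace V Q] [IsManifold 𝓘(ℝ, V) ∞ Q]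
  {E : Q → Type*} [∀ q, AddCommGroup (E q)] [∀ q, Module ℝ (E q)] [∀ q, TopologicalSpace (E q)]
  [TopologicalSpace (TotalSpace F E)] [FiberBundle F E]

variable (V) in
theorem exists_smooth_bump {q₀ : Q} {U : Set Q} (hU : U ∈ 𝓝 q₀) :
    ∃ χ : Q → ℝ, ContMDiff 𝓘(ℝ, V) 𝓘(ℝ, ℝ) ∞ χ ∧ tsupport χ ⊆ U ∧ ∀ᶠ q in 𝓝 q₀, χ q = 1 := by
  obtain ⟨χ, hχ, -⟩ := (SmoothBumpFunction.nhds_basis_support (I := 𝓘(ℝ, V)) hU).mem_iff.1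
    (univ_mem : (univ : Set Q) ∈ 𝓝 q₀)
  exact ⟨χ, χ.contMDiff, hχ, χ.eventuallyEq_one⟩

variable (V F E) in
/-- Global smooth sections that restrict to a frame near `q₀`, with the coordinates of the frame,
cut off to global smooth functions on the total space. -/
structure FrameAt (q₀ : Q) where
  sec : Fin (Module.finrank ℝ F) → ∀ q, E q
  coord : Fin (Module.finrank ℝ F) → ∀ q, E q →ₗ[ℝ] ℝ
  smooth_sec : ∀ k, SmoothSection V F (sec k)
  smooth_coord : ∀ k, ContMDiff (𝓘(ℝ, V).prod 𝓘(ℝ, F)) 𝓘(ℝ, ℝ) ∞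
    fun x : TotalSpace F E => coord k x.1 x.2
  sum_coord : ∀ᶠ q in 𝓝 q₀, ∀ a, ∑ k, coord k q a • sec k q = a
  coord_sec : ∀ k l, coord k q₀ (sec l q₀) = if k = l then 1 else 0
  sec_eq : ∀ᶠ q in 𝓝 q₀, ∀ k,
    sec k q = (trivializationAt F E q₀).symm q (Module.finBasis ℝ F k)

variable [VectorBundle ℝ F E] [ContMDiffVectorBundle ∞ F E 𝓘(ℝ, V)]

theorem nonempty_frameAt (q₀ : Q) : Nonempty (FrameAt V F E q₀) := by
  set t := trivializationAt F E q₀ with ht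
  have hq : t.baseSet ∈ 𝓝 q₀ := t.open_baseSet.mem_nhds (mem_baseSet_trivializationAt F E q₀)
  obtain ⟨χ, hχ, hs, h1⟩ := exists_smooth_bump V hq
  set b := Module.finBasis ℝ F
  have hsymm : ∀ q ∈ t.baseSet, ∀ a : E q, t.symm q (t.linearMapAt ℝ q a) = a := fun q h a => by
    rw [← t.symmₗ_apply (R := ℝ) h, t.symmₗ_linearMapAt h]
  have hlin : ∀ q ∈ t.baseSet, ∀ y : F, t.linearMapAt ℝ q (t.symm q y) = y := fun q h a => by
    rw [← t.symmₗ_apply (R := ℝ) h, t.linearMapAt_symmₗ h]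
  -- Sections and coordinates each carry a factor `χ`, so the expansion in the frame has the factor
  -- `χ²` and holds only where `χ = 1`, near `q₀`.
  refine ⟨⟨fun k q => χ q • t.symm q (b k), fun k q => χ q • b.coord k ∘ₗ t.linearMapAt ℝ q,
    fun k => ?_, fun k => ?_, ?_, fun k l => ?_, ?_⟩⟩
  · have h2 : ContMDiffOn 𝓘(ℝ, V) (𝓘(ℝ, V).prod 𝓘(ℝ, F)) ∞
        (fun q => TotalSpace.mk' F q (t.symm q (b k))) t.baseSet := by
      rw [t.contMDiffOn_section_baseSet_iff]
      exact contMDiffOn_const (c := b k) |>.congr fun q h => by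
        exact (congrFun (t.coe_linearMapAt_of_mem (R := ℝ) h) _).symm.trans (hlin q h _)
    exact ContMDiffOn.smul_section_of_tsupport hχ.contMDiffOn t.open_baseSet hs h2
  · refine (ContMDiffOn.mul_comp_of_tsupport (contMDiff_proj E) hχ t.open_baseSet hs
      (g := fun x => b.coord k (t.linearMapAt ℝ x.1 x.2)) ?_)
    have h2 : ContMDiffOn (𝓘(ℝ, V).prod 𝓘(ℝ, F)) 𝓘(ℝ, F) ∞ (fun x : TotalSpace F E => (t x).2)
        (TotalSpace.proj ⁻¹' t.baseSet) := by
      rw [← t.source_eq]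
      exact contMDiff_snd.comp_contMDiffOn t.contMDiffOn
    have h3 : ContMDiff 𝓘(ℝ, F) 𝓘(ℝ, ℝ) ∞ (b.coord k) :=
      (b.coord k).toContinuousLinearMap.contDiff.contMDiff
    refine (h3.comp_contMDiffOn h2).congr fun x hx => ?_
    rw [t.coe_linearMapAt_of_mem hx]
    rfl
  · filter_upwards [h1, hq] with q hq1 hqt a
    simp only [hq1, one_smul, LinearMap.comp_apply]
    conv_rhs => rw [← hsymm q hqt a, ← b.sum_repr (t.linearMapAt ℝ q a)]
    rw [← t.symmₗ_apply (R := ℝ) hqt, map_sum]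
    exact Finset.sum_congr rfl fun x _ => by
      rw [map_smul, t.symmₗ_apply (R := ℝ) hqt, Module.Basis.coord_apply]
  · have h0 := h1.self_of_nhds
    simp only [h0, one_smul, LinearMap.comp_apply]
    rw [hlin q₀ (mem_of_mem_nhds hq)]
    simp [Finsupp.single_apply, eq_comm]
  · filter_upwards [h1] with q hq1 k
    simp [hq1, ht, b]

theorem exists_smoothSection {q₀ : Q} (a : E q₀) : ∃ σ : ∀ q, E q, SmoothSection V F σ ∧ σ q₀ = a := by
  obtain ⟨φ⟩ := nonempty_frameAt (V := V) (F := F) (E := E) q₀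
  refine ⟨fun q => ∑ k, φ.coord k q₀ a • φ.sec k q, ?_, φ.sum_coord.self_of_nhds a⟩
  exact ContMDiff.sum_section fun k _ => ContMDiff.const_smul_section (φ.smooth_sec k)

end Frame

/-! ### Locality of the bracket, and the anchor as a Lie algebra morphism -/

section AlgebroidLemmas

variable {V F Q : Type*} [NormedAddCommGroup V] [NormedSpace ℝ V] [FiniteDimensional ℝ V]
  [NormedAddCommGroup F] [NormedSpace ℝ F] [FiniteDimensional ℝ F]
  [TopologicalSpace Q] [T2Space Q] [ChartedSpace V Q] [IsManifold 𝓘(ℝ, V) ∞ Q]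
  {E : Q → Type*} [∀ q, AddCommGroup (E q)] [∀ q, Module ℝ (E q)] [∀ q, TopologicalSpace (E q)]
  [TopologicalSpace (TotalSpace F E)] [FiberBundle F E] [VectorBundle ℝ F E]
  [ContMDiffVectorBundle ∞ F E 𝓘(ℝ, V)]
  {σ σ' τ τ' υ : ∀ q, E q} {f g : Q → ℝ}

section Smooth

theorem SmoothSection.add (hσ : SmoothSection V F σ) (hτ : SmoothSection V F τ) :
    SmoothSection V F (σ + τ) :=
  ContMDiff.add_section hσ hτ

theorem SmoothSection.neg (hσ : SmoothSection V F σ) : SmoothSection V F (-σ) :=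
  ContMDiff.neg_section hσ

theorem SmoothSection.smul (hf : ContMDiff 𝓘(ℝ, V) 𝓘(ℝ, ℝ) ∞ f) (hσ : SmoothSection V F σ) :
    SmoothSection V F fun q => f q • σ q :=
  ContMDiff.smul_section hf hσ

theorem SmoothSection.sum {ι : Type*} (s : Finset ι) {σ : ι → ∀ q, E q}
    (hσ : ∀ i ∈ s, SmoothSection V F (σ i)) :
    SmoothSection V F fun q => ∑ i ∈ s, σ i q :=
  ContMDiff.sum_section hσ

end Smooth

namespace LieAlgebroid

variable (𝓔 : LieAlgebroid V F E)

theorem contMDiff_anchor_section (hσ : SmoothSection V F σ) :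
    ContMDiff 𝓘(ℝ, V) 𝓘(ℝ, V).tangent ∞
      fun q => (⟨q, 𝓔.anchor q (σ q)⟩ : TangentBundle 𝓘(ℝ, V) Q) :=
  𝓔.contMDiff_anchor.comp hσ

/-- The derivative `ρ(σ) f` of a function along the anchor of a section. -/
def act (σ : ∀ q, E q) (f : Q → ℝ) (q : Q) : ℝ :=
  dirDeriv 𝓘(ℝ, V) f q (𝓔.anchor q (σ q))

theorem contMDiff_act (hσ : SmoothSection V F σ) (hf : ContMDiff 𝓘(ℝ, V) 𝓘(ℝ, ℝ) ∞ f) :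
    ContMDiff 𝓘(ℝ, V) 𝓘(ℝ, ℝ) ∞ (𝓔.act σ f) :=
  hf.dirDeriv_apply (𝓔.contMDiff_anchor_section hσ)

theorem bracket_smul_right (hf : ContMDiff 𝓘(ℝ, V) 𝓘(ℝ, ℝ) ∞ f) (hσ : SmoothSection V F σ)
    (hτ : SmoothSection V F τ) (q : Q) :
    𝓔.bracket σ (fun q => f q • τ q) q = f q • 𝓔.bracket σ τ q + 𝓔.act σ f q • τ q :=
  𝓔.leibniz f σ τ hf hσ hτ q

theorem bracket_smul_right' (hf : ContMDiff 𝓘(ℝ, V) 𝓘(ℝ, ℝ) ∞ f) (hσ : SmoothSection V F σ)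
    (hτ : SmoothSection V F τ) :
    𝓔.bracket σ (fun q => f q • τ q) =
      (fun q => f q • 𝓔.bracket σ τ q) + fun q => 𝓔.act σ f q • τ q :=
  funext (𝓔.bracket_smul_right hf hσ hτ)

theorem bracket_zero (hσ : SmoothSection V F σ) : 𝓔.bracket σ 0 = 0 := by
  simpa using 𝓔.bracket_smul 0 σ σ hσ hσ

theorem bracket_neg (hσ : SmoothSection V F σ) (hτ : SmoothSection V F τ) :
    𝓔.bracket σ (-τ) = -𝓔.bracket σ τ := by
  simpa using 𝓔.bracket_smul (-1) σ τ hσ hτ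

/-- If `χ` is supported where `τ = 0`, then `χτ = 0` globally. Expanding its bracket by Leibniz at
`q`, where `χ = 1` to first order, leaves only the bracket of `τ`. -/
theorem bracket_eq_zero (hσ : SmoothSection V F σ) (hτ : SmoothSection V F τ) {q : Q}
    (h : ∀ᶠ y in 𝓝 q, τ y = 0) : 𝓔.bracket σ τ q = 0 := by
  obtain ⟨χ, hχ, hs, h1⟩ := exists_smooth_bump V h
  have h0 : (fun y => χ y • τ y) = 0 := by
    funext y
    by_cases hy : χ y = 0
    · simp [hy]
    · have : τ y = 0 := hs (subset_tsupport _ hy)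
      simp [this]
  have h2 := 𝓔.bracket_smul_right hχ hσ hτ q
  have h3 : 𝓔.act σ χ q = 0 := by
    have h4 : χ =ᶠ[𝓝 q] fun _ => 1 := h1
    rw [act, h4.dirDeriv_eq, dirDeriv_const]
    rfl
  rw [h0, 𝓔.bracket_zero hσ, h3, h1.self_of_nhds] at h2
  simpa using h2.symm

theorem bracket_congr_right (hσ : SmoothSection V F σ) (hτ : SmoothSection V F τ)
    (hτ' : SmoothSection V F τ') {q : Q} (h : ∀ᶠ y in 𝓝 q, τ y = τ' y) :
    𝓔.bracket σ τ q = 𝓔.bracket σ τ' q := by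
  have h1 : τ = τ' + (τ + -τ') := by abel
  rw [h1, 𝓔.bracket_add σ τ' _ hσ hτ' (hτ.add hτ'.neg), Pi.add_apply,
    𝓔.bracket_eq_zero hσ (hτ.add hτ'.neg), add_zero]
  filter_upwards [h] with y hy
  simp [hy]

theorem bracket_congr_left (hσ : SmoothSection V F σ) (hσ' : SmoothSection V F σ')
    (hτ : SmoothSection V F τ) {q : Q} (h : ∀ᶠ y in 𝓝 q, σ y = σ' y) :
    𝓔.bracket σ τ q = 𝓔.bracket σ' τ q := by
  rw [𝓔.bracket_antisymm σ τ hσ hτ, 𝓔.bracket_antisymm σ' τ hσ' hτ, Pi.neg_apply, Pi.neg_apply,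
    𝓔.bracket_congr_right hτ hσ hσ' h]

theorem bracket_sum_right {ι : Type*} (s : Finset ι) {g : ι → Q → ℝ} {τ : ι → ∀ q, E q}
    (hσ : SmoothSection V F σ) (hg : ∀ i ∈ s, ContMDiff 𝓘(ℝ, V) 𝓘(ℝ, ℝ) ∞ (g i))
    (hτ : ∀ i ∈ s, SmoothSection V F (τ i)) (q : Q) :
    𝓔.bracket σ (fun q => ∑ i ∈ s, g i q • τ i q) q =
      ∑ i ∈ s, (g i q • 𝓔.bracket σ (τ i) q + 𝓔.act σ (g i) q • τ i q) := by
  classical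
  induction s using Finset.induction_on with
  | empty => exact congrFun (𝓔.bracket_zero hσ) q
  | insert a s ha ih =>
    simp only [Finset.sum_insert ha]
    have h1 := (SmoothSection.smul (hg a (by simp)) (hτ a (by simp)))
    have h2 := SmoothSection.sum s fun i hi =>
      (SmoothSection.smul (hg i (by simp [hi])) (hτ i (by simp [hi])))
    refine (congrFun (𝓔.bracket_add σ _ _ hσ h1 h2) q).trans ?_
    rw [Pi.add_apply, 𝓔.bracket_smul_right (hg a (by simp)) hσ (hτ a (by simp)),
      ih (fun i hi => hg i (by simp [hi])) fun i hi => hτ i (by simp [hi])]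

theorem bracket_sum_left {ι : Type*} (s : Finset ι) {f : ι → Q → ℝ} {σ : ι → ∀ q, E q}
    (hf : ∀ i ∈ s, ContMDiff 𝓘(ℝ, V) 𝓘(ℝ, ℝ) ∞ (f i))
    (hσ : ∀ i ∈ s, SmoothSection V F (σ i)) (hτ : SmoothSection V F τ) (q : Q) :
    𝓔.bracket (fun q => ∑ i ∈ s, f i q • σ i q) τ q =
      ∑ i ∈ s, (f i q • 𝓔.bracket (σ i) τ q - 𝓔.act τ (f i) q • σ i q) := by
  have h1 := SmoothSection.sum s fun i hi => SmoothSection.smul (hf i hi) (hσ i hi)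
  rw [𝓔.bracket_antisymm _ τ h1 hτ, Pi.neg_apply, 𝓔.bracket_sum_right s hτ hf hσ,
    ← Finset.sum_neg_distrib]
  refine Finset.sum_congr rfl fun i hi => ?_
  rw [𝓔.bracket_antisymm _ τ (hσ i hi) hτ, Pi.neg_apply]
  module

theorem jacobi_leibniz (hσ : SmoothSection V F σ) (hτ : SmoothSection V F τ)
    (hυ : SmoothSection V F υ) :
    𝓔.bracket σ (𝓔.bracket τ υ) =
      𝓔.bracket τ (𝓔.bracket σ υ) + 𝓔.bracket (𝓔.bracket σ τ) υ := by
  have h := 𝓔.jacobi σ τ υ hσ hτ hυ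
  rw [𝓔.bracket_antisymm υ σ hυ hσ, 𝓔.bracket_neg hτ (𝓔.smooth_bracket _ _ hσ hυ),
    𝓔.bracket_antisymm υ _ hυ (𝓔.smooth_bracket _ _ hσ hτ)] at h
  rw [← sub_eq_zero, ← h]
  abel

theorem bracket_bracket_smul (hf : ContMDiff 𝓘(ℝ, V) 𝓘(ℝ, ℝ) ∞ f) (hσ : SmoothSection V F σ)
    (hτ : SmoothSection V F τ) (hυ : SmoothSection V F υ) (q : Q) :
    𝓔.bracket σ (𝓔.bracket τ fun q => f q • υ q) q =
      f q • 𝓔.bracket σ (𝓔.bracket τ υ) q + 𝓔.act σ f q • 𝓔.bracket τ υ q +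
        (𝓔.act τ f q • 𝓔.bracket σ υ q + 𝓔.act σ (𝓔.act τ f) q • υ q) := by
  have h1 := 𝓔.smooth_bracket _ _ hτ hυ
  have h2 := 𝓔.contMDiff_act hτ hf
  rw [𝓔.bracket_smul_right' hf hτ hυ, 𝓔.bracket_add σ _ _ hσ (SmoothSection.smul hf h1)
    (SmoothSection.smul h2 hυ), Pi.add_apply, 𝓔.bracket_smul_right hf hσ h1,
    𝓔.bracket_smul_right h2 hσ hυ]

/-- The anchor is a morphism of Lie algebras, as a consequence of the Jacobi identity. -/
theorem act_bracket (hf : ContMDiff 𝓘(ℝ, V) 𝓘(ℝ, ℝ) ∞ f) (hσ : SmoothSection V F σ)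
    (hτ : SmoothSection V F τ) (q : Q) :
    𝓔.act (𝓔.bracket σ τ) f q = 𝓔.act σ (𝓔.act τ f) q - 𝓔.act τ (𝓔.act σ f) q := by
  -- Over a zero fibre both anchored vectors vanish. Otherwise Jacobi for `fυ`, minus `f` times
  -- Jacobi for `υ`, leaves the defect as a multiple of `υ q`, and `υ` can be taken with `υ q ≠ 0`.
  by_cases hE : ∀ a : E q, a = 0
  · simp [act, hE]
  push Not at hE
  obtain ⟨a, ha⟩ := hE
  obtain ⟨υ, hυ, rfl⟩ := exists_smoothSection (V := V) (F := F) a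
  have h1 := congrFun (𝓔.jacobi_leibniz hσ hτ (SmoothSection.smul hf hυ)) q
  have h2 := congrFun (𝓔.jacobi_leibniz hσ hτ hυ) q
  rw [Pi.add_apply, 𝓔.bracket_bracket_smul hf hσ hτ hυ, 𝓔.bracket_bracket_smul hf hτ hσ hυ,
    𝓔.bracket_smul_right hf (𝓔.smooth_bracket _ _ hσ hτ) hυ, h2, Pi.add_apply] at h1
  have h3 : (𝓔.act (𝓔.bracket σ τ) f q - (𝓔.act σ (𝓔.act τ f) q - 𝓔.act τ (𝓔.act σ f) q)) •
      υ q = 0 := by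
    rw [← sub_eq_zero] at h1
    rw [← neg_eq_zero, ← h1]
    module
  exact sub_eq_zero.1 ((smul_eq_zero.1 h3).resolve_right ha)

end LieAlgebroid

end AlgebroidLemmas

/-! ### The bracket of the prolongation is well defined -/

/-- The algebra behind independence of the representation: `A` holds the frame coordinates of the
sections, `D i j k` the derivative of `A j k` along the `i`-th section, and `df`, `dg` the
derivatives of the coefficients. The derivative terms from the brackets combine with `df` and `dg`
through the product rule. -/
theorem sum_change_of_frame {ι κ M : Type*} [Fintype ι] [Fintype κ] [AddCommGroup M] [Module ℝ M]
    (f g df dg : ι → ℝ) (A : ι → κ → ℝ) (D : ι → ι → κ → ℝ) (b : κ → κ → M) (e : κ → M) :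
    ∑ i, ∑ j, (f i * g j) • (∑ k, ∑ l, (A i k * A j l) • b k l + ∑ k, (D i j k - D j i k) • e k) +
        ∑ i, (dg i - df i) • ∑ k, A i k • e k =
      ∑ k, ∑ l, ((∑ i, f i * A i k) * ∑ j, g j * A j l) • b k l +
        ∑ k, (∑ j, (g j * ∑ i, f i * D i j k + A j k * dg j) -
          ∑ i, (f i * ∑ j, g j * D j i k + A i k * df i)) • e k := by
  have h1 : ∑ i, ∑ j, (f i * g j) • ∑ k, ∑ l, (A i k * A j l) • b k l =
      ∑ k, ∑ l, ((∑ i, f i * A i k) * ∑ j, g j * A j l) • b k l := by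
    simp only [Finset.smul_sum, Finset.sum_mul_sum, Finset.sum_smul]
    calc _ = ∑ i, ∑ k, ∑ j, ∑ l, (f i * g j) • (A i k * A j l) • b k l :=
          Finset.sum_congr rfl fun i _ => Finset.sum_comm
      _ = ∑ k, ∑ i, ∑ j, ∑ l, (f i * g j) • (A i k * A j l) • b k l := Finset.sum_comm
      _ = ∑ k, ∑ i, ∑ l, ∑ j, (f i * g j) • (A i k * A j l) • b k l :=
          Finset.sum_congr rfl fun k _ => Finset.sum_congr rfl fun i _ => Finset.sum_comm
      _ = ∑ k, ∑ l, ∑ i, ∑ j, (f i * g j) • (A i k * A j l) • b k l :=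
          Finset.sum_congr rfl fun k _ => Finset.sum_comm
      _ = _ := Finset.sum_congr rfl fun k _ => Finset.sum_congr rfl fun l _ =>
          Finset.sum_congr rfl fun i _ => Finset.sum_congr rfl fun j _ => by
            rw [smul_smul]
            congr 1
            ring
  have h2 : ∑ i, ∑ j, (f i * g j) • ∑ k, (D i j k - D j i k) • e k =
      ∑ k, (∑ i, ∑ j, (f i * g j) * (D i j k - D j i k)) • e k := by
    simp only [Finset.smul_sum, Finset.sum_smul, smul_smul]
    calc _ = ∑ i, ∑ k, ∑ j, (f i * g j * (D i j k - D j i k)) • e k :=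
          Finset.sum_congr rfl fun i _ => Finset.sum_comm
      _ = _ := Finset.sum_comm
  have h3 : ∑ i, (dg i - df i) • ∑ k, A i k • e k = ∑ k, (∑ i, (dg i - df i) * A i k) • e k := by
    simp only [Finset.smul_sum, Finset.sum_smul, smul_smul]
    exact Finset.sum_comm
  simp only [smul_add, Finset.sum_add_distrib]
  rw [h1, h2, h3, add_assoc, ← Finset.sum_add_distrib]
  congr 1
  refine Finset.sum_congr rfl fun k _ => ?_
  rw [← add_smul]
  congr 1
  have h4 : ∑ j, g j * ∑ i, f i * D i j k = ∑ i, ∑ j, f i * g j * D i j k := by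
    simp only [Finset.mul_sum]
    rw [Finset.sum_comm]
    exact Finset.sum_congr rfl fun i _ => Finset.sum_congr rfl fun j _ => by ring
  have h5 : ∑ i, f i * ∑ j, g j * D j i k = ∑ i, ∑ j, f i * g j * D j i k := by
    simp only [Finset.mul_sum]
    exact Finset.sum_congr rfl fun i _ => Finset.sum_congr rfl fun j _ => by ring
  rw [h4, h5]
  simp only [mul_sub, sub_mul, Finset.sum_sub_distrib]
  have h6 : ∀ u : ι → ℝ, ∑ i, A i k * u i = ∑ i, u i * A i k := fun u =>
    Finset.sum_congr rfl fun i _ => mul_comm _ _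
  rw [h6, h6]
  ring

section Prolongation

variable {V F Q : Type*} [NormedAddCommGroup V] [NormedSpace ℝ V] [FiniteDimensional ℝ V]
  [NormedAddCommGroup F] [NormedSpace ℝ F] [FiniteDimensional ℝ F]
  [TopologicalSpace Q] [T2Space Q] [ChartedSpace V Q] [IsManifold 𝓘(ℝ, V) ∞ Q]
  {E : Q → Type*} [∀ q, AddCommGroup (E q)] [∀ q, Module ℝ (E q)] [∀ q, TopologicalSpace (E q)]
  [TopologicalSpace (TotalSpace F E)] [FiberBundle F E] [VectorBundle ℝ F E]
  [ContMDiffVectorBundle ∞ F E 𝓘(ℝ, V)]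

namespace LieAlgebroid

variable (𝓔 : LieAlgebroid V F E)

variable {W K P : Type*} [NormedAddCommGroup W] [NormedSpace ℝ W] [TopologicalSpace K]
  {J : ModelWithCorners ℝ W K} [TopologicalSpace P] [ChartedSpace K P]
  [IsManifold J ∞ P] {pr : P → Q}

variable (pr) in
/-- The first component of the bracket on the prolongation, computed from a representation of the
two sections. -/
def prolFst {r : ℕ} (σ : Fin r → ∀ q, E q) (f g : Fin r → P → ℝ) (p : P)
    (v₁ v₂ : TangentSpace J p) : E (pr p) :=
  ∑ i, ∑ j, (f i p * g j p) • 𝓔.bracket (σ i) (σ j) (pr p) +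
    ∑ i, (dirDeriv J (g i) p v₁ - dirDeriv J (f i) p v₂) • σ i (pr p)

theorem anchor_prol (Z : ∀ p, 𝓔.Prol J pr p) (p : P) :
    𝓔.anchor (pr p) (Z p).1.1 = mfderiv J 𝓘(ℝ, V) pr p (Z p).1.2 :=
  (Z p).2

theorem dirDeriv_comp_prol (hpr : ContMDiff J 𝓘(ℝ, V) ∞ pr) (Z : ∀ p, 𝓔.Prol J pr p) {h : Q → ℝ}
    (hh : ContMDiff 𝓘(ℝ, V) 𝓘(ℝ, ℝ) ∞ h) (p : P) :
    dirDeriv J (fun y => h (pr y)) p (Z p).1.2 =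
      dirDeriv 𝓘(ℝ, V) h (pr p) (𝓔.anchor (pr p) (Z p).1.1) := by
  rw [𝓔.anchor_prol]
  exact dirDeriv_comp (hh.mdifferentiable (by simp) _) (hpr.mdifferentiable (by simp) _) _

/-- The coordinates of the first component of a section of the prolongation. -/
def frameCoord {q₀ : Q} (φ : FrameAt V F E q₀) (Z : ∀ p, 𝓔.Prol J pr p)
    (k : Fin (Module.finrank ℝ F)) (p : P) : ℝ :=
  φ.coord k (pr p) (Z p).1.1

variable {𝓔}

theorem ProlSmooth.frameCoord {q₀ : Q} (φ : FrameAt V F E q₀) {Z : ∀ p, 𝓔.Prol J pr p}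
    (hZ : 𝓔.ProlSmooth Z) (k : Fin (Module.finrank ℝ F)) :
    ContMDiff J 𝓘(ℝ, ℝ) ∞ (𝓔.frameCoord φ Z k) :=
  (φ.smooth_coord k).comp hZ.1

theorem eventually_sum_frameCoord (hpr : ContMDiff J 𝓘(ℝ, V) ∞ pr) {p : P}
    (φ : FrameAt V F E (pr p)) (Z : ∀ p, 𝓔.Prol J pr p) :
    ∀ᶠ y in 𝓝 p, (Z y).1.1 = ∑ k, 𝓔.frameCoord φ Z k y • φ.sec k (pr y) := by
  filter_upwards [hpr.continuous.continuousAt.eventually φ.sum_coord] with y hy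
  exact (hy _).symm

variable (𝓔)

/-- By locality both sections may be replaced by their frame expansions near `q₀`; Leibniz in each
slot does the rest. -/
theorem bracket_frame {q₀ : Q} (φ : FrameAt V F E q₀) {σ τ : ∀ q, E q}
    (hσ : SmoothSection V F σ) (hτ : SmoothSection V F τ) :
    𝓔.bracket σ τ q₀ =
      ∑ k, ∑ l, (φ.coord k q₀ (σ q₀) * φ.coord l q₀ (τ q₀)) • 𝓔.bracket (φ.sec k) (φ.sec l) q₀ +
      ∑ k, (𝓔.act σ (fun q => φ.coord k q (τ q)) q₀ -
        𝓔.act τ (fun q => φ.coord k q (σ q)) q₀) • φ.sec k q₀ := by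
  have hc : ∀ {υ : ∀ q, E q} (hυ : SmoothSection V F υ) k,
      ContMDiff 𝓘(ℝ, V) 𝓘(ℝ, ℝ) ∞ fun q => φ.coord k q (υ q) :=
    fun hυ k => (φ.smooth_coord k).comp hυ
  have hs : ∀ υ : ∀ q, E q, ∀ᶠ q in 𝓝 q₀, υ q = ∑ k, φ.coord k q (υ q) • φ.sec k q := by
    intro υ
    filter_upwards [φ.sum_coord] with q hq using (hq _).symm
  have hS : ∀ {υ : ∀ q, E q} (hυ : SmoothSection V F υ),
      SmoothSection V F fun q => ∑ k, φ.coord k q (υ q) • φ.sec k q :=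
    fun hυ => SmoothSection.sum _ fun k _ => SmoothSection.smul (hc hυ k) (φ.smooth_sec k)
  have h1 : ∀ l, 𝓔.bracket σ (φ.sec l) q₀ =
      ∑ k, (φ.coord k q₀ (σ q₀) • 𝓔.bracket (φ.sec k) (φ.sec l) q₀ -
        𝓔.act (φ.sec l) (fun q => φ.coord k q (σ q)) q₀ • φ.sec k q₀) := fun l => by
    rw [𝓔.bracket_congr_left hσ (hS hσ) (φ.smooth_sec l) (hs σ),
      𝓔.bracket_sum_left _ (fun k _ => hc hσ k) (fun k _ => φ.smooth_sec k) (φ.smooth_sec l)]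
  -- Differentiation along `τ` depends only on the value of `τ` at `q₀`, hence is linear in its
  -- frame coordinates.
  have h2 : ∀ k, 𝓔.act τ (fun q => φ.coord k q (σ q)) q₀ =
      ∑ l, φ.coord l q₀ (τ q₀) * 𝓔.act (φ.sec l) (fun q => φ.coord k q (σ q)) q₀ := fun k => by
    conv_lhs => rw [act, (hs τ).self_of_nhds]
    simp only [map_sum, map_smul, smul_eq_mul]
    rfl
  rw [𝓔.bracket_congr_right hσ hτ (hS hτ) (hs τ),
    𝓔.bracket_sum_right _ hσ (fun k _ => hc hτ k) (fun k _ => φ.smooth_sec k)]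
  simp only [h1, h2, Finset.sum_add_distrib, sub_smul, Finset.sum_sub_distrib, smul_sub,
    Finset.smul_sum, Finset.sum_smul, smul_smul]
  rw [Finset.sum_comm (f := fun l k => (φ.coord l q₀ (τ q₀) * φ.coord k q₀ (σ q₀)) • _),
    Finset.sum_comm (f := fun l k => (φ.coord l q₀ (τ q₀) *
      𝓔.act (φ.sec l) (fun q => φ.coord k q (σ q)) q₀) • _)]
  simp only [mul_comm (φ.coord _ q₀ (τ q₀)) (φ.coord _ q₀ (σ q₀))]
  abel

/-- Any two representations agree because each agrees with the one in a fixed frame. The frame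
coordinate of a section is a sum of coefficients times functions pulled back from `Q`; a pulled-back
function is differentiated through the anchor of the first component, so only data of `E` appear. -/
theorem prolFst_eq_frame (hpr : ContMDiff J 𝓘(ℝ, V) ∞ pr) {Z₁ Z₂ : ∀ p, 𝓔.Prol J pr p} {p : P}
    (φ : FrameAt V F E (pr p)) {r : ℕ} {σ : Fin r → ∀ q, E q} {f g : Fin r → P → ℝ}
    (hσ : ∀ i, SmoothSection V F (σ i)) (hf : ∀ i, ContMDiff J 𝓘(ℝ, ℝ) ∞ (f i))
    (hg : ∀ i, ContMDiff J 𝓘(ℝ, ℝ) ∞ (g i))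
    (h₁ : ∀ᶠ y in 𝓝 p, (Z₁ y).1.1 = ∑ i, f i y • σ i (pr y))
    (h₂ : ∀ᶠ y in 𝓝 p, (Z₂ y).1.1 = ∑ i, g i y • σ i (pr y)) :
    𝓔.prolFst pr σ f g p (Z₁ p).1.2 (Z₂ p).1.2 =
      𝓔.prolFst pr φ.sec (𝓔.frameCoord φ Z₁) (𝓔.frameCoord φ Z₂) p (Z₁ p).1.2 (Z₂ p).1.2 := by
  have hC : ∀ i k, ContMDiff 𝓘(ℝ, V) 𝓘(ℝ, ℝ) ∞ fun q => φ.coord k q (σ i q) :=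
    fun i k => (φ.smooth_coord k).comp (hσ i)
  have hcoord : ∀ {Z : ∀ p, 𝓔.Prol J pr p} {g : Fin r → P → ℝ},
      (∀ᶠ y in 𝓝 p, (Z y).1.1 = ∑ i, g i y • σ i (pr y)) → ∀ k,
      𝓔.frameCoord φ Z k =ᶠ[𝓝 p] fun y => ∑ i, g i y * φ.coord k (pr y) (σ i (pr y)) := by
    intro Z g h k
    filter_upwards [h] with y hy
    simp [frameCoord, hy]
  have hact : ∀ {Z : ∀ p, 𝓔.Prol J pr p} {g : Fin r → P → ℝ},
      (∀ᶠ y in 𝓝 p, (Z y).1.1 = ∑ i, g i y • σ i (pr y)) → ∀ i k,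
      dirDeriv J (fun y => φ.coord k (pr y) (σ i (pr y))) p (Z p).1.2 =
        ∑ j, g j p * 𝓔.act (σ j) (fun q => φ.coord k q (σ i q)) (pr p) := by
    intro Z g h i k
    rw [𝓔.dirDeriv_comp_prol hpr Z (hC i k), h.self_of_nhds]
    simp only [map_sum, map_smul, smul_eq_mul]
    rfl
  have hderiv : ∀ {Z Z' : ∀ p, 𝓔.Prol J pr p} {f g : Fin r → P → ℝ},
      (∀ i, ContMDiff J 𝓘(ℝ, ℝ) ∞ (g i)) →
      (∀ᶠ y in 𝓝 p, (Z' y).1.1 = ∑ i, f i y • σ i (pr y)) →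
      (∀ᶠ y in 𝓝 p, (Z y).1.1 = ∑ i, g i y • σ i (pr y)) → ∀ k,
      dirDeriv J (𝓔.frameCoord φ Z k) p (Z' p).1.2 =
        ∑ j, (g j p * ∑ i, f i p * 𝓔.act (σ i) (fun q => φ.coord k q (σ j q)) (pr p) +
          φ.coord k (pr p) (σ j (pr p)) * dirDeriv J (g j) p (Z' p).1.2) := by
    intro Z Z' f g hg h' h k
    have hd : ∀ j, MDifferentiableAt J 𝓘(ℝ, ℝ) (fun y => φ.coord k (pr y) (σ j (pr y))) p :=
      fun j => ((hC j k).comp hpr).mdifferentiable (by simp) p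
    rw [(hcoord h k).dirDeriv_eq, 
      dirDeriv_sum_mul _ (fun j => (hg j).mdifferentiable (by simp) p) hd]
    exact Finset.sum_congr rfl fun j _ => by rw [hact h']
  have hb : ∀ i, σ i (pr p) = ∑ k, φ.coord k (pr p) (σ i (pr p)) • φ.sec k (pr p) :=
    fun i => (φ.sum_coord.self_of_nhds _).symm
  unfold prolFst
  simp only [hderiv hg h₁ h₂, hderiv hf h₂ h₁, fun k => (hcoord h₁ k).self_of_nhds,
    fun k => (hcoord h₂ k).self_of_nhds]
  rw [← sum_change_of_frame (fun i => f i p) (fun i => g i p)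
    (fun i => dirDeriv J (f i) p (Z₂ p).1.2) (fun i => dirDeriv J (g i) p (Z₁ p).1.2)
    (fun i k => φ.coord k (pr p) (σ i (pr p)))
    (fun i j k => 𝓔.act (σ i) (fun q => φ.coord k q (σ j q)) (pr p))
    (fun k l => 𝓔.bracket (φ.sec k) (φ.sec l) (pr p)) (fun k => φ.sec k (pr p))]
  congr 1
  · exact Finset.sum_congr rfl fun i _ => Finset.sum_congr rfl fun j _ => by
      rw [𝓔.bracket_frame φ (hσ i) (hσ j)]
  · exact Finset.sum_congr rfl fun i _ => by rw [← hb i]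

theorem dirDeriv_dirDeriv_prol (hpr : ContMDiff J 𝓘(ℝ, V) ∞ pr) {Z Z' : ∀ p, 𝓔.Prol J pr p}
    (hZ : 𝓔.ProlSmooth Z) {p : P} (φ : FrameAt V F E (pr p))
    {h : Q → ℝ} (hh : ContMDiff 𝓘(ℝ, V) 𝓘(ℝ, ℝ) ∞ h) :
    dirDeriv J (fun y => dirDeriv J (fun y => h (pr y)) y (Z y).1.2) p (Z' p).1.2 =
      ∑ k, (𝓔.frameCoord φ Z k p *
          ∑ i, 𝓔.frameCoord φ Z' i p * 𝓔.act (φ.sec i) (𝓔.act (φ.sec k) h) (pr p) +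
        𝓔.act (φ.sec k) h (pr p) * dirDeriv J (𝓔.frameCoord φ Z k) p (Z' p).1.2) := by
  have h1 : (fun y => dirDeriv J (fun y => h (pr y)) y (Z y).1.2) =ᶠ[𝓝 p]
      fun y => ∑ k, 𝓔.frameCoord φ Z k y * 𝓔.act (φ.sec k) h (pr y) := by
    filter_upwards [eventually_sum_frameCoord hpr φ Z] with y hy
    rw [𝓔.dirDeriv_comp_prol hpr Z hh, hy]
    simp only [map_sum, map_smul, smul_eq_mul]
    rfl
  have h2 : ∀ k, ContMDiff 𝓘(ℝ, V) 𝓘(ℝ, ℝ) ∞ (𝓔.act (φ.sec k) h) :=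
    fun k => 𝓔.contMDiff_act (φ.smooth_sec k) hh
  have h3 : ∀ k, MDifferentiableAt J 𝓘(ℝ, ℝ) (fun y => 𝓔.act (φ.sec k) h (pr y)) p :=
    fun k => ((h2 k).comp hpr).mdifferentiable (by simp) p
  have h4 : ∀ k, MDifferentiableAt J 𝓘(ℝ, ℝ) (𝓔.frameCoord φ Z k) p :=
    fun k => (hZ.frameCoord φ k).mdifferentiable (by simp) p
  rw [h1.dirDeriv_eq, dirDeriv_sum_mul _ h4 h3]
  refine Finset.sum_congr rfl fun k _ => ?_
  rw [𝓔.dirDeriv_comp_prol hpr Z' (h2 k),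
    (eventually_sum_frameCoord hpr φ Z').self_of_nhds]
  simp only [map_sum, map_smul, smul_eq_mul]
  rfl

/-- Tested on functions `h` on `Q`: the commutator of two derivatives of `h ∘ pr` expands in the
frame, and its second-order part is the anchor of the brackets of frame sections by `act_bracket`.
-/
theorem anchor_prolFst [CompleteSpace W] [J.Boundaryless] (hpr : ContMDiff J 𝓘(ℝ, V) ∞ pr)
    {Z₁ Z₂ : ∀ p, 𝓔.Prol J pr p} (hZ₁ : 𝓔.ProlSmooth Z₁) (hZ₂ : 𝓔.ProlSmooth Z₂) {p : P}
    (φ : FrameAt V F E (pr p)) :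
    𝓔.anchor (pr p)
        (𝓔.prolFst pr φ.sec (𝓔.frameCoord φ Z₁) (𝓔.frameCoord φ Z₂) p (Z₁ p).1.2 (Z₂ p).1.2) =
      mfderiv J 𝓘(ℝ, V) pr p
        (VectorField.mlieBracket J (fun p => (Z₁ p).1.2) (fun p => (Z₂ p).1.2) p) := by
  refine eq_of_forall_dirDeriv_eq fun h hh => ?_
  rw [← dirDeriv_comp (hh.mdifferentiable (by simp) _) (hpr.mdifferentiable (by simp) _),
    dirDeriv_mlieBracket (f := fun y => h (pr y)) (hh.comp hpr) hZ₁.2 hZ₂.2, 𝓔.dirDeriv_dirDeriv_prol hpr hZ₂ φ hh,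
    𝓔.dirDeriv_dirDeriv_prol hpr hZ₁ φ hh, prolFst]
  have h1 : ∀ i j, dirDeriv 𝓘(ℝ, V) h (pr p)
      (𝓔.anchor (pr p) (𝓔.bracket (φ.sec i) (φ.sec j) (pr p))) = _ :=
    fun i j => 𝓔.act_bracket hh (φ.smooth_sec i) (φ.smooth_sec j) (pr p)
  have h2 : ∀ i, dirDeriv 𝓘(ℝ, V) h (pr p) (𝓔.anchor (pr p) (φ.sec i (pr p))) =
    𝓔.act (φ.sec i) h (pr p) := fun i => rfl
  simp only [map_add, map_sum, map_smul, smul_eq_mul, h1, h2, mul_sub, sub_mul,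
    Finset.sum_add_distrib, Finset.sum_sub_distrib, Finset.mul_sum]
  rw [Finset.sum_comm (f := fun k i => 𝓔.frameCoord φ Z₂ k p *
    (𝓔.frameCoord φ Z₁ i p * 𝓔.act (φ.sec i) (𝓔.act (φ.sec k) h) (pr p)))]
  have h3 : ∀ a b c : ℝ, a * b * c = b * (a * c) := fun a b c => by ring
  have h4 : ∀ a b : Fin (Module.finrank ℝ F) → ℝ, ∑ i, a i * b i = ∑ i, b i * a i :=
    fun a b => Finset.sum_congr rfl fun i _ => mul_comm _ _
  rw [h4 (fun i => dirDeriv J _ p (Z₁ p).1.2), h4 (fun i => dirDeriv J _ p (Z₂ p).1.2)]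
  simp only [h3, mul_left_comm (𝓔.frameCoord φ Z₂ _ p)]
  ring

/-- The chosen bracket has its defining property once a witness exists. The frame expression is one,
since every other representation gives the same value. -/
theorem isProlBracket_bracket [CompleteSpace W] [J.Boundaryless]
    (hpr : ContMDiff J 𝓘(ℝ, V) ∞ pr) {Z₁ Z₂ : ∀ p, 𝓔.Prol J pr p}
    (hZ₁ : 𝓔.ProlSmooth Z₁) (hZ₂ : 𝓔.ProlSmooth Z₂) (p : P) :
    𝓔.IsProlBracket Z₁ Z₂ p ((𝓔.prolongation J pr).bracket Z₁ Z₂ p) := by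
  obtain ⟨φ⟩ := nonempty_frameAt (V := V) (F := F) (E := E) (pr p)
  refine Classical.epsilon_spec (p := 𝓔.IsProlBracket Z₁ Z₂ p)
    ⟨⟨(_, _), 𝓔.anchor_prolFst hpr hZ₁ hZ₂ φ⟩, rfl, ?_⟩
  intro r σ f g hσ hf hg h₁ h₂
  exact (𝓔.prolFst_eq_frame hpr φ hσ hf hg h₁ h₂).symm

theorem bracket_snd [CompleteSpace W] [J.Boundaryless]
    (hpr : ContMDiff J 𝓘(ℝ, V) ∞ pr) {Z₁ Z₂ : ∀ p, 𝓔.Prol J pr p}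
    (hZ₁ : 𝓔.ProlSmooth Z₁) (hZ₂ : 𝓔.ProlSmooth Z₂) (p : P) :
    ((𝓔.prolongation J pr).bracket Z₁ Z₂ p).1.2 =
      VectorField.mlieBracket J (fun p => (Z₁ p).1.2) (fun p => (Z₂ p).1.2) p :=
  (𝓔.isProlBracket_bracket hpr hZ₁ hZ₂ p).1

theorem bracket_fst [CompleteSpace W] [J.Boundaryless]
    (hpr : ContMDiff J 𝓘(ℝ, V) ∞ pr) {Z₁ Z₂ : ∀ p, 𝓔.Prol J pr p}
    (hZ₁ : 𝓔.ProlSmooth Z₁) (hZ₂ : 𝓔.ProlSmooth Z₂) {p : P} (φ : FrameAt V F E (pr p)) :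
    ((𝓔.prolongation J pr).bracket Z₁ Z₂ p).1.1 =
      𝓔.prolFst pr φ.sec (𝓔.frameCoord φ Z₁) (𝓔.frameCoord φ Z₂) p (Z₁ p).1.2 (Z₂ p).1.2 :=
  (𝓔.isProlBracket_bracket hpr hZ₁ hZ₂ p).2 _ φ.sec _ _ φ.smooth_sec (hZ₁.frameCoord φ)
    (hZ₂.frameCoord φ) (eventually_sum_frameCoord hpr φ Z₁) (eventually_sum_frameCoord hpr φ Z₂)

end LieAlgebroid

end Prolongation

/-! ### Charts of E* × ℝ and extension of vectors of the prolongation -/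

section Phase

variable {V F Q : Type*} [NormedAddCommGroup V] [NormedSpace ℝ V] [FiniteDimensional ℝ V]
  [NormedAddCommGroup F] [NormedSpace ℝ F] [FiniteDimensional ℝ F]
  [TopologicalSpace Q] [T2Space Q] [ChartedSpace V Q] [IsManifold 𝓘(ℝ, V) ∞ Q]
  {E : Q → Type*} [∀ q, AddCommGroup (E q)] [∀ q, Module ℝ (E q)] [∀ q, TopologicalSpace (E q)]
  [TopologicalSpace (TotalSpace F E)] [FiberBundle F E] [VectorBundle ℝ F E]
  [ContMDiffVectorBundle ∞ F E 𝓘(ℝ, V)]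

theorem contMDiff_phaseProj : ContMDiff (phaseModel V F) 𝓘(ℝ, V) ∞ (phaseProj F E) :=
  (Bundle.contMDiff_proj (n := ∞) (F := F →L[ℝ] ℝ) (IB := 𝓘(ℝ, V))
      (fun q : Q => E q →L[ℝ] Bundle.Trivial Q ℝ q)).comp contMDiff_fst

theorem ContMDiff.snd_trivial {W K N : Type*} [NormedAddCommGroup W] [NormedSpace ℝ W]
    [TopologicalSpace K] {J : ModelWithCorners ℝ W K} [TopologicalSpace N] [ChartedSpace K N]
    {b : N → Q} {u : N → ℝ}
    (h : ContMDiff J (𝓘(ℝ, V).prod 𝓘(ℝ, ℝ)) ∞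
      fun n => TotalSpace.mk' ℝ (E := Bundle.Trivial Q ℝ) (b n) (u n)) :
    ContMDiff J 𝓘(ℝ, ℝ) ∞ u :=
  fun n => (contMDiffAt_totalSpace.1 (h n)).2

theorem contMDiff_pairing {a : ∀ p : PhaseSpace F E, E (phaseProj F E p)}
    (ha : ContMDiff (phaseModel V F) (𝓘(ℝ, V).prod 𝓘(ℝ, F)) ∞
      fun p => TotalSpace.mk' F (phaseProj F E p) (a p)) :
    ContMDiff (phaseModel V F) 𝓘(ℝ, ℝ) ∞ fun p : PhaseSpace F E => (p.1.2 (a p) : ℝ) :=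
  ContMDiff.snd_trivial (V := V) (b := phaseProj F E)
    (ContMDiff.clm_bundle_apply (F₁ := F) (F₂ := ℝ) (E₁ := E) (E₂ := Bundle.Trivial Q ℝ)
      (b := phaseProj F E) (ϕ := fun p => p.1.2) contMDiff_fst ha)

/-- The momentum function `(b, s) ↦ b(σ)` of a section `σ` of `E`. -/
def momentum (σ : ∀ q, E q) (p : PhaseSpace F E) : ℝ :=
  p.1.2 (σ p.1.proj)

theorem contMDiff_momentum {σ : ∀ q, E q} (hσ : SmoothSection V F σ) :
    ContMDiff (phaseModel V F) 𝓘(ℝ, ℝ) ∞ (momentum (F := F) σ) :=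
  contMDiff_pairing (a := fun p => σ (phaseProj F E p)) (hσ.comp contMDiff_phaseProj)

variable (V F E) in
/-- The domain in `Q` of the chart of `E* × ℝ` at points over `q₀`. -/
def phaseBase (q₀ : Q) : Set Q :=
  (chartAt V q₀).source ∩ (trivializationAt F E q₀).baseSet

theorem isOpen_phaseBase (q₀ : Q) : IsOpen (phaseBase V F E q₀) :=
  (chartAt V q₀).open_source.inter (trivializationAt F E q₀).open_baseSet

theorem mem_phaseBase (q₀ : Q) : q₀ ∈ phaseBase V F E q₀ :=
  ⟨mem_chart_source V q₀, mem_baseSet_trivializationAt F E q₀⟩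

/-- Chart domains are full preimages of open sets of `Q`, so cut-off functions pulled back from `Q`
suffice. -/
theorem mem_phaseChart_source {p₀ p : PhaseSpace F E} :
    p ∈ (chartAt (ModelProd (ModelProd V (F →L[ℝ] ℝ)) ℝ) p₀).source ↔
      phaseProj F E p ∈ phaseBase V F E (phaseProj F E p₀) := by
  rw [← extChartAt_source (phaseModel V F), extChartAt_prod, PartialEquiv.prod_source,
    FiberBundle.extChartAt]
  simp only [PartialEquiv.trans_source, PartialEquiv.prod_source, mfld_simps, phaseBase, phaseProj]
  constructor
  · rintro ⟨⟨h1, h2⟩, -⟩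
    exact ⟨h2, h1.1⟩
  · rintro ⟨h1, h2⟩
    exact ⟨⟨⟨h2, trivial⟩, h1⟩, trivial⟩

theorem phaseChart_apply (p₀ p : PhaseSpace F E) :
    extChartAt (phaseModel V F) p₀ p =
      ((extChartAt 𝓘(ℝ, V) (phaseProj F E p₀) (phaseProj F E p),
        (trivializationAt (F →L[ℝ] ℝ) (fun q : Q => E q →L[ℝ] Bundle.Trivial Q ℝ q)
          (phaseProj F E p₀) p.1).2), p.2) := by
  rw [extChartAt_prod, FiberBundle.extChartAt]
  rfl

theorem mfderiv_clm_comp {W W' K N : Type*} [NormedAddCommGroup W] [NormedSpace ℝ W]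
    [NormedAddCommGroup W'] [NormedSpace ℝ W']
    {W₀ : Type*} [NormedAddCommGroup W₀] [NormedSpace ℝ W₀]
    [TopologicalSpace K] {J : ModelWithCorners ℝ W₀ K} [TopologicalSpace N] [ChartedSpace K N]
    (l : W →L[ℝ] W') {φ : N → W} {n : N} (hφ : MDifferentiableAt J 𝓘(ℝ, W) φ n)
    (v : TangentSpace J n) :
    mfderiv J 𝓘(ℝ, W') (fun y => l (φ y)) n v = l (mfderiv J 𝓘(ℝ, W) φ n v) := by
  have h := mfderiv_comp n (I'' := 𝓘(ℝ, W')) l.differentiableAt.mdifferentiableAt hφ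
  rw [mfderiv_eq_fderiv, ContinuousLinearMap.fderiv] at h
  exact congrArg (fun L => L v) h

/-- The tangent map of the chart of `E* × ℝ` at `p₀`, at the point `p`. -/
def phaseCoord (p₀ p : PhaseSpace F E) :
    TangentSpace (phaseModel V F) p →L[ℝ] (V × (F →L[ℝ] ℝ)) × ℝ :=
  mfderiv (phaseModel V F) 𝓘(ℝ, (V × (F →L[ℝ] ℝ)) × ℝ) (extChartAt (phaseModel V F) p₀) p

theorem mdifferentiableAt_phaseChart {p₀ p : PhaseSpace F E}
    (hp : phaseProj F E p ∈ phaseBase V F E (phaseProj F E p₀)) :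
    MDifferentiableAt (phaseModel V F) 𝓘(ℝ, (V × (F →L[ℝ] ℝ)) × ℝ)
      (extChartAt (phaseModel V F) p₀) p := by
  have : IsManifold (phaseModel V F) 1 (PhaseSpace F E) := IsManifold.of_le (n := ∞) (by simp)
  exact mdifferentiableAt_extChartAt (mem_phaseChart_source.2 hp)

theorem phaseCoord_bijective {p₀ p : PhaseSpace F E}
    (hp : phaseProj F E p ∈ phaseBase V F E (phaseProj F E p₀)) :
    Function.Bijective (phaseCoord (V := V) p₀ p) := by
  have : IsManifold (phaseModel V F) 1 (PhaseSpace F E) := IsManifold.of_le (n := ∞) (by simp)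
  have h := isInvertible_mfderiv_extChartAt (I := phaseModel V F) (x := p₀) (y := p)
    (by rw [extChartAt_source]; exact mem_phaseChart_source.2 hp)
  exact h.bijective

theorem phaseCoord_base {p₀ p : PhaseSpace F E}
    (hp : phaseProj F E p ∈ phaseBase V F E (phaseProj F E p₀))
    (v : TangentSpace (phaseModel V F) p) :
    (phaseCoord p₀ p v).1.1 =
      mfderiv 𝓘(ℝ, V) 𝓘(ℝ, V) (extChartAt 𝓘(ℝ, V) (phaseProj F E p₀)) (phaseProj F E p)
        (mfderiv (phaseModel V F) 𝓘(ℝ, V) (phaseProj F E) p v) := by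
  have : IsManifold 𝓘(ℝ, V) 1 Q := IsManifold.of_le (n := ∞) (by simp)
  have h1 := mfderiv_clm_comp
    (ContinuousLinearMap.fst ℝ V (F →L[ℝ] ℝ) ∘L ContinuousLinearMap.fst ℝ (V × (F →L[ℝ] ℝ)) ℝ)
    (mdifferentiableAt_phaseChart hp) v
  have h2 := mfderiv_comp p
    (mdifferentiableAt_extChartAt (I := 𝓘(ℝ, V)) (x := phaseProj F E p₀) hp.1)
    ((contMDiff_phaseProj (E := E)).mdifferentiable (by simp) p)
  have h3 : (fun y => (ContinuousLinearMap.fst ℝ V (F →L[ℝ] ℝ) ∘L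
      ContinuousLinearMap.fst ℝ (V × (F →L[ℝ] ℝ)) ℝ) (extChartAt (phaseModel V F) p₀ y)) =
      extChartAt 𝓘(ℝ, V) (phaseProj F E p₀) ∘ phaseProj F E := by
    funext y
    rw [phaseChart_apply]
    rfl
  rw [h3, h2] at h1
  exact h1.symm

theorem dirDeriv_snd_eq (p₀ : PhaseSpace F E) (v : TangentSpace (phaseModel V F) p₀) :
    dirDeriv (phaseModel V F) (Prod.snd : PhaseSpace F E → ℝ) p₀ v = (phaseCoord p₀ p₀ v).2 := by
  have h1 := mfderiv_clm_comp (ContinuousLinearMap.snd ℝ (V × (F →L[ℝ] ℝ)) ℝ)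
    (mdifferentiableAt_phaseChart (mem_phaseBase (phaseProj F E p₀))) v
  have h3 : (fun y => (ContinuousLinearMap.snd ℝ (V × (F →L[ℝ] ℝ)) ℝ)
      (extChartAt (phaseModel V F) p₀ y)) = Prod.snd := by
    funext y
    rw [phaseChart_apply]
    rfl
  rw [h3] at h1
  exact h1

/-- Near `p₀` the frame consists of the images of the basis of `F` under the trivialization, so the
momenta are the fibre coordinates of the chart of `E* × ℝ`. -/
theorem dirDeriv_momentum_eq (p₀ : PhaseSpace F E) (φ : FrameAt V F E (phaseProj F E p₀))
    (k : Fin (Module.finrank ℝ F)) (v : TangentSpace (phaseModel V F) p₀) :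
    dirDeriv (phaseModel V F) (momentum (φ.sec k)) p₀ v =
      (phaseCoord p₀ p₀ v).1.2 (Module.finBasis ℝ F k) := by
  have h1 := mfderiv_clm_comp (ContinuousLinearMap.apply ℝ ℝ (Module.finBasis ℝ F k) ∘L
    ContinuousLinearMap.snd ℝ V (F →L[ℝ] ℝ) ∘L ContinuousLinearMap.fst ℝ (V × (F →L[ℝ] ℝ)) ℝ)
    (mdifferentiableAt_phaseChart (mem_phaseBase (phaseProj F E p₀))) v
  have h3 : momentum (φ.sec k) =ᶠ[𝓝 p₀] (fun y =>
      (ContinuousLinearMap.apply ℝ ℝ (Module.finBasis ℝ F k) ∘L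
      ContinuousLinearMap.snd ℝ V (F →L[ℝ] ℝ) ∘L ContinuousLinearMap.fst ℝ (V × (F →L[ℝ] ℝ)) ℝ)
      (extChartAt (phaseModel V F) p₀ y)) := by
    have hU := (isOpen_phaseBase (V := V) (F := F) (E := E) (phaseProj F E p₀)).mem_nhds
      (mem_phaseBase _)
    filter_upwards [(contMDiff_phaseProj (V := V) (E := E)).continuous.continuousAt.eventually
      (φ.sec_eq.and hU)] with y hy
    have hk : φ.sec k y.1.proj = (trivializationAt F E (phaseProj F E p₀)).symm y.1.proj
      (Module.finBasis ℝ F k) := hy.1 k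
    rw [phaseChart_apply, momentum, hk]
    change _ = ContinuousLinearMap.inCoordinates F E ℝ (Bundle.Trivial Q ℝ) (phaseProj F E p₀)
      y.1.proj (phaseProj F E p₀) y.1.proj y.1.2 (Module.finBasis ℝ F k)
    have hs : (trivializationAt F E (phaseProj F E p₀)).symmL ℝ y.1.proj
        (Module.finBasis ℝ F k) = (trivializationAt F E (phaseProj F E p₀)).symm y.1.proj
          (Module.finBasis ℝ F k) :=
      Trivialization.symmL_apply _ hy.2.2 _
    rw [← hs, ContinuousLinearMap.inCoordinates]
    simp
  rw [h3.dirDeriv_eq]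
  exact h1

theorem tangent_trivializationAt_snd {W K N : Type*} [NormedAddCommGroup W] [NormedSpace ℝ W]
    [TopologicalSpace K] {J : ModelWithCorners ℝ W K} [TopologicalSpace N] [ChartedSpace K N]
    [IsManifold J 1 N] {x₀ x : N} (hx : x ∈ (chartAt K x₀).source) (v : TangentSpace J x) :
    (trivializationAt W (TangentSpace J) x₀ ⟨x, v⟩).2 = mfderiv J 𝓘(ℝ, W) (extChartAt J x₀) x v := by
  rw [← TangentBundle.continuousLinearMapAt_trivializationAt hx]
  exact (congrFun ((trivializationAt W (TangentSpace J) x₀).coe_linearMapAt_of_mem (R := ℝ) hx)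
    v).symm

theorem mfderiv_extChartAt_injective {W K N : Type*} [NormedAddCommGroup W] [NormedSpace ℝ W]
    [TopologicalSpace K] {J : ModelWithCorners ℝ W K} [TopologicalSpace N] [ChartedSpace K N]
    [IsManifold J 1 N] {x₀ x : N} (hx : x ∈ (chartAt K x₀).source) :
    Function.Injective (mfderiv J 𝓘(ℝ, W) (extChartAt J x₀) x) :=
  (isInvertible_mfderiv_extChartAt (by rwa [extChartAt_source])).injective

variable (𝓔 : LieAlgebroid V F E)

/-- Vectors of the prolongation extend to smooth sections. -/
theorem LieAlgebroid.exists_prolSmooth (p₀ : PhaseSpace F E)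
    (z : 𝓔.Prol (phaseModel V F) (phaseProj F E) p₀) :
    ∃ Z : ∀ p, 𝓔.Prol (phaseModel V F) (phaseProj F E) p, 𝓔.ProlSmooth Z ∧ Z p₀ = z := by
  have : IsManifold (phaseModel V F) 1 (PhaseSpace F E) := IsManifold.of_le (n := ∞) (by simp)
  have : IsManifold 𝓘(ℝ, V) 1 Q := IsManifold.of_le (n := ∞) (by simp)
  obtain ⟨A, hA, hAz⟩ := exists_smoothSection (V := V) (F := F) z.1.1
  set q₀ := phaseProj F E p₀ with hq₀
  obtain ⟨χ, hχ, hs, h1⟩ := exists_smooth_bump V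
    ((isOpen_phaseBase (V := V) (F := F) (E := E) q₀).mem_nhds (mem_phaseBase q₀))
  have hpr := contMDiff_phaseProj (V := V) (F := F) (E := E)
  set t := trivializationAt ((V × (F →L[ℝ] ℝ)) × ℝ) (TangentSpace (phaseModel V F)) p₀
  set tQ := trivializationAt V (TangentSpace 𝓘(ℝ, V)) q₀
  -- The base component is forced to be the anchor of `A` read in the chart of `Q`; the two other
  -- components are frozen at their values for `z`.
  let w : PhaseSpace F E → (V × (F →L[ℝ] ℝ)) × ℝ := fun p =>
    (((tQ ⟨phaseProj F E p, 𝓔.anchor _ (A (phaseProj F E p))⟩).2, (phaseCoord p₀ p₀ z.1.2).1.2),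
      (phaseCoord p₀ p₀ z.1.2).2)
  let X : ∀ p, TangentSpace (phaseModel V F) p := fun p => t.symm p (w p)
  have hXw : ∀ {p}, phaseProj F E p ∈ phaseBase V F E q₀ → phaseCoord p₀ p (X p) = w p := by
    intro p hp
    have hp' := mem_phaseChart_source.2 hp
    refine (tangent_trivializationAt_snd hp' (X p)).symm.trans ?_
    exact congrArg Prod.snd (t.apply_mk_symm hp' (w p))
  have hX : ContMDiffOn (phaseModel V F) (phaseModel V F).tangent ∞
      (fun p => (⟨p, X p⟩ : TangentBundle (phaseModel V F) (PhaseSpace F E)))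
      (phaseProj F E ⁻¹' phaseBase V F E q₀) := by
    rw [t.contMDiffOn_section_iff ((isOpen_phaseBase q₀).preimage hpr.continuous)
      fun p hp => mem_phaseChart_source.2 hp]
    have h2 : ContMDiffOn (phaseModel V F) 𝓘(ℝ, V) ∞ (fun p : PhaseSpace F E =>
        (tQ ⟨phaseProj F E p, 𝓔.anchor _ (A (phaseProj F E p))⟩).2)
        (phaseProj F E ⁻¹' phaseBase V F E q₀) :=
      (contMDiff_snd.comp_contMDiffOn tQ.contMDiffOn).comp
        ((𝓔.contMDiff_anchor_section hA).comp hpr).contMDiffOn fun p hp =>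
          tQ.mem_source.2 hp.1
    have h3 : ContMDiffOn (phaseModel V F) 𝓘(ℝ, (V × (F →L[ℝ] ℝ)) × ℝ) ∞ w
        (phaseProj F E ⁻¹' phaseBase V F E q₀) :=
      (h2.prodMk_space contMDiffOn_const).prodMk_space contMDiffOn_const
    exact h3.congr fun p hp =>
      congrArg Prod.snd (t.apply_mk_symm (mem_phaseChart_source.2 hp) (w p))
  have hmem : ∀ p, 𝓔.anchor _ (χ (phaseProj F E p) • A (phaseProj F E p)) =
      mfderiv (phaseModel V F) 𝓘(ℝ, V) (phaseProj F E) p (χ (phaseProj F E p) • X p) := by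
    intro p
    refine ((𝓔.anchor _).map_smul _ _).trans (Eq.trans ?_
      ((mfderiv (phaseModel V F) 𝓘(ℝ, V) (phaseProj F E) p).map_smul _ _).symm)
    -- Off the chart domain the cut-off is zero and the compatibility condition is trivial; inside
    -- it is checked in the chart of `Q`.
    by_cases h0 : χ (phaseProj F E p) = 0
    · rw [h0, zero_smul, zero_smul]
    · have hp : phaseProj F E p ∈ phaseBase V F E q₀ := hs (subset_tsupport _ h0)
      congr 1
      apply mfderiv_extChartAt_injective (J := 𝓘(ℝ, V)) hp.1
      have e := phaseCoord_base hp (X p)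
      rw [hXw hp] at e
      exact (tangent_trivializationAt_snd (J := 𝓘(ℝ, V)) hp.1 _).symm.trans e
  refine ⟨fun p => ⟨(χ (phaseProj F E p) • A (phaseProj F E p), χ (phaseProj F E p) • X p),
    hmem p⟩, ⟨?_, ?_⟩, ?_⟩
  · exact (SmoothSection.smul hχ hA).comp hpr
  · refine ContMDiffOn.smul_section_of_tsupport (ψ := fun p => χ (phaseProj F E p))
      (hχ.comp hpr).contMDiffOn ((isOpen_phaseBase q₀).preimage hpr.continuous) ?_ hX
    exact (tsupport_comp_subset_preimage χ hpr.continuous).trans (preimage_mono hs)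
  · refine Subtype.ext (Prod.ext ?_ ?_)
    · change χ q₀ • A q₀ = _
      rw [h1.self_of_nhds, hAz, one_smul]
    · change χ q₀ • X p₀ = _
      rw [h1.self_of_nhds, one_smul]
      apply (phaseCoord_bijective (V := V) (mem_phaseBase (phaseProj F E p₀))).1
      rw [hXw (mem_phaseBase _)]
      refine Prod.ext (Prod.ext ?_ rfl) rfl
      rw [phaseCoord_base (mem_phaseBase _)]
      refine (tangent_trivializationAt_snd (mem_chart_source V q₀) _).trans ?_
      congr 1
      exact (congrArg (𝓔.anchor q₀) hAz).trans z.2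

end Phase

/-! ### The differential of a one-section evaluated on sections -/

namespace AlgebroidData

variable {V H M : Type*} [NormedAddCommGroup V] [NormedSpace ℝ V] [TopologicalSpace H]
  {I : ModelWithCorners ℝ V H} [TopologicalSpace M] [ChartedSpace H M]
  {A : M → Type*} [∀ x, AddCommGroup (A x)] [∀ x, Module ℝ (A x)]
  (𝒜 : AlgebroidData I A)

theorem extend_spec {x : M} {a : A x} (h : ∃ σ : ∀ y, A y, 𝒜.IsSmooth σ ∧ σ x = a) :
    𝒜.IsSmooth (𝒜.extend x a) ∧ 𝒜.extend x a x = a :=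
  Classical.epsilon_spec h

theorem evalD_oneForm (η : ∀ x, A x →ₗ[ℝ] ℝ) (σ τ : ∀ x, A x) (x : M) :
    𝒜.evalD (oneForm η) ![σ, τ] x =
      𝒜.dFun (fun y => η y (τ y)) x (σ x) - 𝒜.dFun (fun y => η y (σ y)) x (τ x) -
        η x (𝒜.bracket σ τ x) := by
  simp [evalD, oneForm, Fin.sum_univ_succ]
  ring

theorem dOne_eq (η : ∀ x, A x →ₗ[ℝ] ℝ) (x : M) (a b : A x) :
    𝒜.dOne η x a b = 𝒜.evalD (oneForm η) ![𝒜.extend x a, 𝒜.extend x b] x := by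
  have h : (fun i => 𝒜.extend x ((![a, b] : Fin 2 → A x) i)) = ![𝒜.extend x a, 𝒜.extend x b] := by
    funext i
    fin_cases i <;> rfl
  rw [dOne, extDeriv, h]

/-- The formula is obtained for the extensions chosen in the definition. This is enough for η, where
the right side turns out to depend only on the two values at the point. -/
theorem exists_dOne_eq (η : ∀ x, A x →ₗ[ℝ] ℝ) {x : M} {a b : A x}
    (ha : ∃ σ : ∀ y, A y, 𝒜.IsSmooth σ ∧ σ x = a) (hb : ∃ σ : ∀ y, A y, 𝒜.IsSmooth σ ∧ σ x = b) :
    ∃ σ τ : ∀ y, A y, 𝒜.IsSmooth σ ∧ 𝒜.IsSmooth τ ∧ σ x = a ∧ τ x = b ∧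
      𝒜.dOne η x a b = 𝒜.dFun (fun y => η y (τ y)) x (σ x) -
        𝒜.dFun (fun y => η y (σ y)) x (τ x) - η x (𝒜.bracket σ τ x) := by
  obtain ⟨hσ, hσa⟩ := 𝒜.extend_spec ha
  obtain ⟨hτ, hτb⟩ := 𝒜.extend_spec hb
  exact ⟨_, _, hσ, hτ, hσa, hτb, by rw [dOne_eq, evalD_oneForm]⟩

theorem evalD_zero {k : ℕ} (σ : Fin (k + 1) → ∀ x, A x) (x : M) :
    𝒜.evalD (fun x => (0 : A x [⋀^Fin k]→ₗ[ℝ] ℝ)) σ x = 0 := by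
  simp [evalD, dFun]

end AlgebroidData

/-! ### The differential of the contact form in a frame -/

section Contact

variable {V F Q : Type*} [NormedAddCommGroup V] [NormedSpace ℝ V] [FiniteDimensional ℝ V]
  [NormedAddCommGroup F] [NormedSpace ℝ F] [FiniteDimensional ℝ F]
  [TopologicalSpace Q] [T2Space Q] [ChartedSpace V Q] [IsManifold 𝓘(ℝ, V) ∞ Q]
  {E : Q → Type*} [∀ q, AddCommGroup (E q)] [∀ q, Module ℝ (E q)] [∀ q, TopologicalSpace (E q)]
  [TopologicalSpace (TotalSpace F E)] [FiberBundle F E] [VectorBundle ℝ F E]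
  [ContMDiffVectorBundle ∞ F E 𝓘(ℝ, V)]

namespace LieAlgebroid

variable (𝓔 : LieAlgebroid V F E)

/-- The pairing of the linear form `b` of a point `(b, s)` with elements of the fibre. -/
def pairing (p : PhaseSpace F E) : E (phaseProj F E p) →ₗ[ℝ] ℝ :=
  p.1.2.toLinearMap

theorem momentum_eq_pairing (σ : ∀ q, E q) (p : PhaseSpace F E) :
    momentum (F := F) σ p = pairing p (σ (phaseProj F E p)) :=
  rfl

theorem contactForm_apply (p : PhaseSpace F E) (z : 𝓔.Prol (phaseModel V F) (phaseProj F E) p) :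
    𝓔.contactForm p z =
      dirDeriv (phaseModel V F) (Prod.snd : PhaseSpace F E → ℝ) p z.1.2 - pairing p z.1.1 :=
  rfl

theorem contMDiff_contactForm {Z : ∀ p, 𝓔.Prol (phaseModel V F) (phaseProj F E) p}
    (hZ : 𝓔.ProlSmooth Z) :
    ContMDiff (phaseModel V F) 𝓘(ℝ, ℝ) ∞ fun p => 𝓔.contactForm p (Z p) :=
  (contMDiff_snd.dirDeriv_apply hZ.2).sub (contMDiff_pairing hZ.1)

theorem isSmoothForm_contactForm :
    𝓔.contactProl.IsSmoothForm (AlgebroidData.oneForm 𝓔.contactForm) :=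
  fun _ hσ => 𝓔.contMDiff_contactForm (hσ 0)

theorem dirDeriv_contactForm {p : PhaseSpace F E} (φ : FrameAt V F E (phaseProj F E p))
    {Z : ∀ p, 𝓔.Prol (phaseModel V F) (phaseProj F E) p} (hZ : 𝓔.ProlSmooth Z)
    (v : TangentSpace (phaseModel V F) p) :
    dirDeriv (phaseModel V F) (fun y => 𝓔.contactForm y (Z y)) p v =
      dirDeriv (phaseModel V F)
        (fun y => dirDeriv (phaseModel V F) (Prod.snd : PhaseSpace F E → ℝ) y (Z y).1.2) p v -
      ∑ k, (𝓔.frameCoord φ Z k p * dirDeriv (phaseModel V F) (momentum (φ.sec k)) p v +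
        momentum (φ.sec k) p * dirDeriv (phaseModel V F) (𝓔.frameCoord φ Z k) p v) := by
  have h1 : (fun y => 𝓔.contactForm y (Z y)) =ᶠ[𝓝 p] fun y =>
      dirDeriv (phaseModel V F) (Prod.snd : PhaseSpace F E → ℝ) y (Z y).1.2 -
        ∑ k, 𝓔.frameCoord φ Z k y * momentum (φ.sec k) y := by
    filter_upwards [eventually_sum_frameCoord contMDiff_phaseProj φ Z] with y hy
    rw [contactForm_apply, hy, map_sum]
    simp only [map_smul, smul_eq_mul, momentum_eq_pairing]
  have h2 := fun k => (hZ.frameCoord φ k).mdifferentiable (by simp) p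
  have h3 := fun k => (contMDiff_momentum (φ.smooth_sec k)).mdifferentiable (by simp) p
  have h4 := (contMDiff_snd.dirDeriv_apply hZ.2).mdifferentiable (by simp) p
  rw [h1.dirDeriv_eq, dirDeriv_sub h4 (MDifferentiableAt.fun_sum_real _ fun k _ =>
    (h2 k).fun_mul_real (h3 k)), dirDeriv_sum_mul _ h2 h3]

theorem contactForm_bracket {p : PhaseSpace F E} (φ : FrameAt V F E (phaseProj F E p))
    {Z₁ Z₂ : ∀ p, 𝓔.Prol (phaseModel V F) (phaseProj F E) p} (hZ₁ : 𝓔.ProlSmooth Z₁)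
    (hZ₂ : 𝓔.ProlSmooth Z₂) :
    𝓔.contactForm p (𝓔.contactProl.bracket Z₁ Z₂ p) =
      dirDeriv (phaseModel V F) (fun y => dirDeriv (phaseModel V F)
        (Prod.snd : PhaseSpace F E → ℝ) y (Z₂ y).1.2) p (Z₁ p).1.2 -
      dirDeriv (phaseModel V F) (fun y => dirDeriv (phaseModel V F)
        (Prod.snd : PhaseSpace F E → ℝ) y (Z₁ y).1.2) p (Z₂ p).1.2 -
      (∑ i, ∑ j, 𝓔.frameCoord φ Z₁ i p * 𝓔.frameCoord φ Z₂ j p *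
          momentum (𝓔.bracket (φ.sec i) (φ.sec j)) p +
        ∑ i, (dirDeriv (phaseModel V F) (𝓔.frameCoord φ Z₂ i) p (Z₁ p).1.2 -
          dirDeriv (phaseModel V F) (𝓔.frameCoord φ Z₁ i) p (Z₂ p).1.2) *
            momentum (φ.sec i) p) := by
  have : CompleteSpace V := FiniteDimensional.complete ℝ V
  rw [contactForm_apply, 𝓔.bracket_snd contMDiff_phaseProj hZ₁ hZ₂,
    𝓔.bracket_fst contMDiff_phaseProj hZ₁ hZ₂ φ, dirDeriv_mlieBracket contMDiff_snd hZ₁.2 hZ₂.2,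
    prolFst]
  simp only [map_add, map_sum, map_smul, smul_eq_mul, momentum_eq_pairing]

/-- Iterated derivatives of the coordinate `s` cancel against the second component of the bracket,
and derivatives of the frame coordinates against its first component; what remains involves the two
vectors at `p` only. -/
theorem dirDeriv_contactForm_sub_bracket {p : PhaseSpace F E}
    (φ : FrameAt V F E (phaseProj F E p))
    {Z₁ Z₂ : ∀ p, 𝓔.Prol (phaseModel V F) (phaseProj F E) p} (hZ₁ : 𝓔.ProlSmooth Z₁)
    (hZ₂ : 𝓔.ProlSmooth Z₂) :
    dirDeriv (phaseModel V F) (fun y => 𝓔.contactForm y (Z₂ y)) p (Z₁ p).1.2 -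
      dirDeriv (phaseModel V F) (fun y => 𝓔.contactForm y (Z₁ y)) p (Z₂ p).1.2 -
      𝓔.contactForm p (𝓔.contactProl.bracket Z₁ Z₂ p) =
      ∑ k, 𝓔.frameCoord φ Z₁ k p *
        dirDeriv (phaseModel V F) (momentum (φ.sec k)) p (Z₂ p).1.2 -
      ∑ k, 𝓔.frameCoord φ Z₂ k p *
        dirDeriv (phaseModel V F) (momentum (φ.sec k)) p (Z₁ p).1.2 +
      ∑ i, ∑ j, 𝓔.frameCoord φ Z₁ i p * 𝓔.frameCoord φ Z₂ j p *
        momentum (𝓔.bracket (φ.sec i) (φ.sec j)) p := by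
  rw [𝓔.dirDeriv_contactForm φ hZ₁, 𝓔.dirDeriv_contactForm φ hZ₂, 𝓔.contactForm_bracket φ hZ₁ hZ₂]
  simp only [sub_mul, Finset.sum_add_distrib, Finset.sum_sub_distrib, mul_comm (momentum _ p)]
  ring

/-- The differential of the contact form in terms of a frame. -/
theorem dOne_contactForm {p : PhaseSpace F E} (φ : FrameAt V F E (phaseProj F E p))
    (z₁ z₂ : 𝓔.Prol (phaseModel V F) (phaseProj F E) p) :
    𝓔.contactProl.dOne 𝓔.contactForm p z₁ z₂ =
      ∑ k, φ.coord k _ z₁.1.1 * dirDeriv (phaseModel V F) (momentum (φ.sec k)) p z₂.1.2 -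
      ∑ k, φ.coord k _ z₂.1.1 * dirDeriv (phaseModel V F) (momentum (φ.sec k)) p z₁.1.2 +
      ∑ i, ∑ j, φ.coord i _ z₁.1.1 * φ.coord j _ z₂.1.1 *
        momentum (𝓔.bracket (φ.sec i) (φ.sec j)) p := by
  obtain ⟨Z₁, Z₂, hZ₁, hZ₂, rfl, rfl, h⟩ := 𝓔.contactProl.exists_dOne_eq 𝓔.contactForm
    (𝓔.exists_prolSmooth p z₁) (𝓔.exists_prolSmooth p z₂)
  exact h.trans (𝓔.dirDeriv_contactForm_sub_bracket φ hZ₁ hZ₂)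

/-- A vector of the prolongation is determined by its first component, the derivatives of the
momenta of a frame and the derivative of the last coordinate. -/
theorem prol_ext {p : PhaseSpace F E} (φ : FrameAt V F E (phaseProj F E p))
    {z z' : 𝓔.Prol (phaseModel V F) (phaseProj F E) p} (h₁ : z.1.1 = z'.1.1)
    (h₂ : ∀ k, dirDeriv (phaseModel V F) (momentum (φ.sec k)) p z.1.2 =
      dirDeriv (phaseModel V F) (momentum (φ.sec k)) p z'.1.2)
    (h₃ : dirDeriv (phaseModel V F) (Prod.snd : PhaseSpace F E → ℝ) p z.1.2 =
      dirDeriv (phaseModel V F) (Prod.snd : PhaseSpace F E → ℝ) p z'.1.2) : z = z' := by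
  refine Subtype.ext (Prod.ext h₁ ?_)
  apply (phaseCoord_bijective (V := V) (mem_phaseBase (phaseProj F E p))).1
  refine Prod.ext (Prod.ext ?_ ?_) ?_
  · rw [phaseCoord_base (mem_phaseBase _), phaseCoord_base (mem_phaseBase _)]
    congr 1
    -- Membership in the prolongation makes the projection to `TQ` the anchor of the first
    -- component.
    exact z.2.symm.trans ((congrArg (𝓔.anchor _) h₁).trans z'.2)
  · apply ContinuousLinearMap.coe_injective
    refine (Module.finBasis ℝ F).ext fun k => ?_
    have := h₂ k
    rwa [dirDeriv_momentum_eq, dirDeriv_momentum_eq] at this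
  · rwa [dirDeriv_snd_eq, dirDeriv_snd_eq] at h₃

/-- In the chart at `p` the base velocity must be the anchor of `a`; the fibre and last components
are free. -/
theorem exists_prol {p : PhaseSpace F E} (φ : FrameAt V F E (phaseProj F E p))
    (a : E (phaseProj F E p)) (β : Fin (Module.finrank ℝ F) → ℝ) (s : ℝ) :
    ∃ z : 𝓔.Prol (phaseModel V F) (phaseProj F E) p, z.1.1 = a ∧
      (∀ k, dirDeriv (phaseModel V F) (momentum (φ.sec k)) p z.1.2 = β k) ∧
      dirDeriv (phaseModel V F) (Prod.snd : PhaseSpace F E → ℝ) p z.1.2 = s := by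
  have : IsManifold 𝓘(ℝ, V) 1 Q := IsManifold.of_le (n := ∞) (by simp)
  obtain ⟨v, hv⟩ := (phaseCoord_bijective (V := V) (mem_phaseBase (phaseProj F E p))).2
    ((mfderiv 𝓘(ℝ, V) 𝓘(ℝ, V) (extChartAt 𝓘(ℝ, V) (phaseProj F E p)) (phaseProj F E p)
      (𝓔.anchor _ a), ((Module.finBasis ℝ F).constr ℝ β).toContinuousLinearMap), s)
  have hm : 𝓔.anchor _ a = mfderiv (phaseModel V F) 𝓘(ℝ, V) (phaseProj F E) p v := by
    apply mfderiv_extChartAt_injective (J := 𝓘(ℝ, V)) (mem_chart_source V (phaseProj F E p))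
    rw [← phaseCoord_base (mem_phaseBase _), hv]
  refine ⟨⟨(a, v), hm⟩, rfl, fun k => ?_, ?_⟩
  · rw [dirDeriv_momentum_eq]
    change (phaseCoord p p v).1.2 _ = _
    rw [hv]
    simp
  · rw [dirDeriv_snd_eq]
    change (phaseCoord p p v).2 = _
    rw [hv]

end LieAlgebroid
end Contact

/-! ### Linear algebra of a contact form on one fibre -/

/-- Linear coordinates `(cₖ, yₖ, η)` of a vector space that carries a linear form `η` and a form
`Ω = ∑ cₖ ∧ yₖ + ∑ Mᵢⱼ cᵢ ⊗ cⱼ`. -/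
structure ContactCoord {X : Type*} [AddCommGroup X] [Module ℝ X] (η : X →ₗ[ℝ] ℝ)
    (Ω : X → X → ℝ) (m : ℕ) where
  c : Fin m → X →ₗ[ℝ] ℝ
  y : Fin m → X →ₗ[ℝ] ℝ
  M : Fin m → Fin m → ℝ
  form_eq : ∀ z w, Ω z w =
    ∑ k, c k z * y k w - ∑ k, c k w * y k z + ∑ i, ∑ j, c i z * c j w * M i j
  eq_zero : ∀ z, (∀ k, c k z = 0) → (∀ k, y k z = 0) → η z = 0 → z = 0
  exists_eq : ∀ (α β : Fin m → ℝ) (s : ℝ), ∃ z,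
    (∀ k, c k z = α k) ∧ (∀ k, y k z = β k) ∧ η z = s

namespace ContactCoord

variable {X : Type*} [AddCommGroup X] [Module ℝ X] {η : X →ₗ[ℝ] ℝ} {Ω : X → X → ℝ} {m : ℕ}

theorem form_add_smul (κ : ContactCoord η Ω m) (z z' w : X) (r : ℝ) : Ω (z + r • z') w = Ω z w + r * Ω z' w := by
  simp only [κ.form_eq, map_add, map_smul, smul_eq_mul, add_mul, mul_add, Finset.sum_add_distrib,
    Finset.mul_sum, mul_sub]
  simp only [mul_assoc, mul_left_comm r]
  ring

/-- This is the nondegenerate pairing: a vector with all `c` zero is detected in its `y` coordinates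
by vectors with prescribed `c`, whatever their `y`. -/
theorem form_of_c_eq_zero (κ : ContactCoord η Ω m) {z w : X} (hz : ∀ k, κ.c k z = 0) {l : Fin m}
    (hw : ∀ k, κ.c k w = if k = l then 1 else 0) : Ω z w = -κ.y l z := by
  simp [κ.form_eq, hz, hw]

theorem exists_reeb (κ : ContactCoord η Ω m) : ∃ R, (∀ w, Ω R w = 0) ∧ η R = 1 := by
  obtain ⟨R, h₁, h₂, h₃⟩ := κ.exists_eq 0 0 1
  exact ⟨R, fun w => by simp [κ.form_eq, h₁, h₂], h₃⟩

theorem reeb_coord (κ : ContactCoord η Ω m) {R : X} (hR : ∀ w, Ω R w = 0) : (∀ k, κ.c k R = 0) ∧ ∀ k, κ.y k R = 0 := by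
  have h : ∀ k, κ.c k R = 0 := fun k => by
    -- Pairing with a vector whose only nonzero coordinate is `y k = 1` reads off `c k R`;
    -- afterwards `y k R` is read off with `c = Pi.single k 1`.
    obtain ⟨w, h₁, h₂, -⟩ := κ.exists_eq 0 (Pi.single k 1) 0
    have := hR w
    simpa [κ.form_eq, h₁, h₂, Pi.single_apply] using this
  refine ⟨h, fun k => ?_⟩
  obtain ⟨w, h₁, -⟩ := κ.exists_eq (Pi.single k 1) 0 0
  have := κ.form_of_c_eq_zero h (fun l => (h₁ l).trans (Pi.single_apply k 1 l))
  linarith [hR w]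

theorem exists_hamiltonian (κ : ContactCoord η Ω m) {R : X} (hR : ∀ w, Ω R w = 0) (hR1 : η R = 1) (Λ : X →ₗ[ℝ] ℝ)
    (hΛ : Λ R = 0) (s : ℝ) : ∃ ξ, η ξ = s ∧ ∀ w, Ω ξ w = Λ w := by
  obtain ⟨hRc, hRy⟩ := κ.reeb_coord hR
  choose ν hν₁ hν₂ hν₃ using fun l : Fin m => κ.exists_eq 0 (Pi.single l 1) 0
  choose h hh₁ hh₂ hh₃ using fun l : Fin m => κ.exists_eq (Pi.single l 1) 0 0
  have hdec : ∀ w, w = ∑ l, κ.c l w • h l + ∑ l, κ.y l w • ν l + η w • R := fun w => by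
    rw [← sub_eq_zero]
    apply κ.eq_zero <;>
    simp [hν₁, hν₂, hν₃, hh₁, hh₂, hh₃, hRc, hRy, hR1, Pi.single_apply]
  -- The coordinates solve `Ω ξ = Λ` on the basis `h`, `ν`, `R` dual to `c`, `y`, `η`: `ν k` forces
  -- `c k ξ = Λ (ν k)`, `h k` then forces `y k ξ`, and `R` imposes nothing since `Λ R = 0`.
  obtain ⟨ξ, h₁, h₂, h₃⟩ := κ.exists_eq (fun k => Λ (ν k))
    (fun k => -Λ (h k) + ∑ i, Λ (ν i) * κ.M i k) s
  refine ⟨ξ, h₃, fun w => ?_⟩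
  conv_rhs => rw [hdec w]
  rw [κ.form_eq, Finset.sum_comm]
  simp only [h₁, h₂, map_add, map_sum, map_smul, hΛ, smul_eq_mul, mul_add, Finset.sum_add_distrib,
    Finset.mul_sum]
  simp only [mul_neg, Finset.sum_neg_distrib, mul_comm (Λ (ν _)), mul_assoc]
  simp only [mul_comm, mul_left_comm]
  ring

end ContactCoord

/-! ### Reeb, Hamiltonian and evolution sections along a Legendrian section -/

section Contact

variable {V F Q : Type*} [NormedAddCommGroup V] [NormedSpace ℝ V] [FiniteDimensional ℝ V]
  [NormedAddCommGroup F] [NormedSpace ℝ F] [FiniteDimensional ℝ F]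
  [TopologicalSpace Q] [T2Space Q] [ChartedSpace V Q] [IsManifold 𝓘(ℝ, V) ∞ Q]
  {E : Q → Type*} [∀ q, AddCommGroup (E q)] [∀ q, Module ℝ (E q)] [∀ q, TopologicalSpace (E q)]
  [TopologicalSpace (TotalSpace F E)] [FiberBundle F E] [VectorBundle ℝ F E]
  [ContMDiffVectorBundle ∞ F E 𝓘(ℝ, V)]

namespace LieAlgebroid

variable (𝓔 : LieAlgebroid V F E)

/-- The derivative of a function on `E* × ℝ` along the anchor, as a linear form on the fibre. -/
def prolDeriv (f : PhaseSpace F E → ℝ) (p : PhaseSpace F E) :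
    𝓔.Prol (phaseModel V F) (phaseProj F E) p →ₗ[ℝ] ℝ :=
  𝓔.contactProl.dFun f p

/-- The first component of a vector of the prolongation. -/
def prolBase (p : PhaseSpace F E) :
    𝓔.Prol (phaseModel V F) (phaseProj F E) p →ₗ[ℝ] E (phaseProj F E p) :=
  LinearMap.fst ℝ (E (phaseProj F E p)) (TangentSpace (phaseModel V F) p) ∘ₗ
    (𝓔.Prol (phaseModel V F) (phaseProj F E) p).subtype

theorem prolBase_apply (p : PhaseSpace F E) (z : 𝓔.Prol (phaseModel V F) (phaseProj F E) p) :
    𝓔.prolBase p z = z.1.1 :=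
  rfl

theorem coord_sum {q : Q} (φ : FrameAt V F E q) (α : Fin (Module.finrank ℝ F) → ℝ)
    (k : Fin (Module.finrank ℝ F)) : φ.coord k q (∑ l, α l • φ.sec l q) = α k := by
  simp [φ.coord_sec]

/-- The coordinates on a fibre of the prolongation given by a frame. -/
def contactCoord {p : PhaseSpace F E} (φ : FrameAt V F E (phaseProj F E p)) :
    ContactCoord (𝓔.contactForm p) (𝓔.contactProl.dOne 𝓔.contactForm p)
      (Module.finrank ℝ F) where
  c k := φ.coord k _ ∘ₗ 𝓔.prolBase p
  y k := 𝓔.prolDeriv (momentum (φ.sec k)) p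
  M i j := momentum (𝓔.bracket (φ.sec i) (φ.sec j)) p
  form_eq z w := 𝓔.dOne_contactForm φ z w
  eq_zero z h₁ h₂ h₃ := by
    have h : z.1.1 = 0 := by
      rw [← φ.sum_coord.self_of_nhds z.1.1]
      exact Finset.sum_eq_zero fun k _ => (congrArg (· • _) (h₁ k)).trans (zero_smul _ _)
    refine 𝓔.prol_ext φ h (fun k => (h₂ k).trans (map_zero _).symm)
      (Eq.trans ?_ (map_zero _).symm)
    rw [contactForm_apply, h, map_zero, sub_zero] at h₃
    exact h₃
  exists_eq α β s := by
    -- As η is `ds` minus the pairing, the value `s` of η is reached by shifting `ds` by the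
    -- pairing.
    obtain ⟨z, h₁, h₂, h₃⟩ := 𝓔.exists_prol φ (∑ k, α k • φ.sec k (phaseProj F E p)) β
      (s + pairing p (∑ k, α k • φ.sec k (phaseProj F E p)))
    refine ⟨z, fun k => ?_, h₂, ?_⟩
    · rw [LinearMap.comp_apply, prolBase_apply, h₁, coord_sum]
    · rw [contactForm_apply, h₁, h₃, add_sub_cancel_right]

theorem nonempty_contactCoord (p : PhaseSpace F E) :
    Nonempty (ContactCoord (𝓔.contactForm p) (𝓔.contactProl.dOne 𝓔.contactForm p)
      (Module.finrank ℝ F)) := by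
  obtain ⟨φ⟩ := nonempty_frameAt (V := V) (F := F) (E := E) (phaseProj F E p)
  exact ⟨𝓔.contactCoord φ⟩

/-- The conditions are pointwise, so solutions in the separate fibres assemble to a section and the
choice is realized. -/
theorem isReeb_reeb :
    𝓔.contactProl.IsReeb 𝓔.contactForm (𝓔.contactProl.reeb 𝓔.contactForm) := by
  choose R hR using fun p => (𝓔.nonempty_contactCoord p).some.exists_reeb
  exact Classical.epsilon_spec (p := 𝓔.contactProl.IsReeb 𝓔.contactForm)
    ⟨R, fun p => (hR p).1, fun p => (hR p).2⟩

theorem isHamiltonian_hamiltonian (H : PhaseSpace F E → ℝ) :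
    𝓔.contactProl.IsHamiltonian 𝓔.contactForm H
      (𝓔.contactProl.hamiltonian 𝓔.contactForm H) := by
  obtain ⟨hR, hR1⟩ := 𝓔.isReeb_reeb
  -- The form dH - R(H)η annihilates R because η(R) = 1, which is the solvability condition.
  choose ξ hξ using fun p => (𝓔.nonempty_contactCoord p).some.exists_hamiltonian (hR p) (hR1 p)
    (𝓔.prolDeriv H p -
      𝓔.prolDeriv H p (𝓔.contactProl.reeb 𝓔.contactForm p) • 𝓔.contactForm p)
    (by simp [hR1 p]) (-H p)
  exact Classical.epsilon_spec (p := 𝓔.contactProl.IsHamiltonian 𝓔.contactForm H)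
    ⟨ξ, fun p => (hξ p).1, fun p w => (hξ p).2 w⟩

theorem contactForm_evolutionSection (H : PhaseSpace F E → ℝ) (p : PhaseSpace F E) :
    𝓔.contactForm p (𝓔.evolutionSection H p) = 0 := by
  rw [evolutionSection, AlgebroidData.evolution, map_add, map_smul,
    (𝓔.isHamiltonian_hamiltonian H).1, 𝓔.isReeb_reeb.2, smul_eq_mul, mul_one, neg_add_cancel]

/-- The summand HR is in the kernel of dη, and the term R(H)η is zero on ker η. -/
theorem dOne_evolutionSection (H : PhaseSpace F E → ℝ) {p : PhaseSpace F E}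
    {w : 𝓔.Prol (phaseModel V F) (phaseProj F E) p} (hw : 𝓔.contactForm p w = 0) :
    𝓔.contactProl.dOne 𝓔.contactForm p (𝓔.evolutionSection H p) w = 𝓔.prolDeriv H p w := by
  rw [evolutionSection, AlgebroidData.evolution,
    (𝓔.nonempty_contactCoord p).some.form_add_smul, (𝓔.isHamiltonian_hamiltonian H).2,
    𝓔.isReeb_reeb.1, hw, mul_zero, mul_zero, sub_zero, add_zero]
  rfl

variable {𝓔}

/-- The differential of the contact form vanishes along a Legendrian section. -/
theorem IsLegendrianSection.dOne_graphMap {γ : PhaseSection V F E}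
    (hγ : 𝓔.IsLegendrianSection γ) (q : Q) (a b : E q) :
    𝓔.contactProl.dOne 𝓔.contactForm (γ.map q) (𝓔.graphMap γ q a) (𝓔.graphMap γ q b) = 0 := by
  have h := hγ.comm_d 1 _ 𝓔.isSmoothForm_contactForm q ![a, b]
  -- The pull-back of η is the zero form, so compatibility with d forces dη to pull back to zero.
  have h0 : AlgebroidData.pullback (𝓔.graphMap γ) (AlgebroidData.oneForm 𝓔.contactForm) =
      fun _ => 0 := by
    funext x
    ext v
    exact hγ.vanishes x (v 0)
  have h1 : (fun l => 𝓔.graphMap γ q ((![a, b] : Fin 2 → E q) l)) =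
      ![𝓔.graphMap γ q a, 𝓔.graphMap γ q b] := by
    funext l
    fin_cases l <;> rfl
  rw [h0, h1, AlgebroidData.extDeriv, AlgebroidData.evalD_zero] at h
  exact h.symm

variable (𝓔)

theorem prolDeriv_graphMap {H : PhaseSpace F E → ℝ}
    (hH : ContMDiff (phaseModel V F) 𝓘(ℝ, ℝ) ∞ H) (γ : PhaseSection V F E) (q : Q) (a : E q) :
    𝓔.prolDeriv H (γ.map q) (𝓔.graphMap γ q a) = 𝓔.data.dFun (H ∘ γ.map) q a :=
  (dirDeriv_comp (hH.mdifferentiable (by simp) _) (γ.smooth.mdifferentiable (by simp) q)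
    (𝓔.anchor q a)).symm

/-- The difference of the two vectors has zero first component, lies in ker η, and is dη-orthogonal
to F_γ. As F_γ contains a vector over each frame element `φ.sec l q`, every `y` coordinate of the
difference vanishes. -/
theorem eq_graphMap {γ : PhaseSection V F E} (hγ : 𝓔.IsLegendrianSection γ) {q : Q}
    {z : 𝓔.Prol (phaseModel V F) (phaseProj F E) (γ.map q)} {a : E q} (ha : z.1.1 = a)
    (hz : 𝓔.contactForm (γ.map q) z = 0)
    (h : ∀ b, 𝓔.contactProl.dOne 𝓔.contactForm (γ.map q) z (𝓔.graphMap γ q b) = 0) :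
    z = 𝓔.graphMap γ q a := by
  obtain ⟨φ⟩ := nonempty_frameAt (V := V) (F := F) (E := E) q
  let κ := 𝓔.contactCoord (p := γ.map q) φ
  have hc : ∀ k, κ.c k (z + (-1 : ℝ) • 𝓔.graphMap γ q a) = 0 := fun k => by
    rw [map_add, map_smul, neg_one_smul, ← sub_eq_add_neg, sub_eq_zero]
    exact congrArg (φ.coord k q) ha
  have h0 : z + (-1 : ℝ) • 𝓔.graphMap γ q a = 0 := by
    refine κ.eq_zero _ hc (fun l => ?_) ?_
    · rw [← neg_eq_zero, ← κ.form_of_c_eq_zero hc (w := 𝓔.graphMap γ q (φ.sec l q))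
        (fun k => φ.coord_sec k l), κ.form_add_smul, h, hγ.dOne_graphMap, mul_zero, add_zero]
    · rw [map_add, map_smul, hz, hγ.vanishes, smul_zero, add_zero]
  refine sub_eq_zero.1 (Eq.trans ?_ h0)
  rw [sub_eq_add_neg]
  exact congrArg (z + ·) (neg_one_smul ℝ _).symm

end LieAlgebroid

end Contact

end

/-! ### The equivalence -/

theorem mainTheorem8
    {V F Q : Type*} [NormedAddCommGroup V] [NormedSpace ℝ V] [FiniteDimensional ℝ V]
    [NormedAddCommGroup F] [NormedSpace ℝ F] [FiniteDimensional ℝ F]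
    [TopologicalSpace Q] [T2Space Q] [ChartedSpace V Q] [IsManifold 𝓘(ℝ, V) ∞ Q]
    {E : Q → Type*} [∀ q, AddCommGroup (E q)] [∀ q, Module ℝ (E q)]
    [∀ q, TopologicalSpace (E q)] [TopologicalSpace (TotalSpace F E)]
    [FiberBundle F E] [VectorBundle ℝ F E] [ContMDiffVectorBundle ∞ F E 𝓘(ℝ, V)]
    (𝓔 : LieAlgebroid V F E)
    (H : PhaseSpace F E → ℝ) (hH : ContMDiff (phaseModel V F) 𝓘(ℝ, ℝ) ∞ H)
    (γ : PhaseSection V F E) (hγ : 𝓔.IsLegendrianSection γ) :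
    𝓔.GammaRelated γ (𝓔.evolutionSection H)
        (𝓔.inducedSection γ (𝓔.evolutionSection H)) ↔
      ∀ q, 𝓔.data.dFun (H ∘ γ.map) q = 0 := by
  have h : ∀ q a, 𝓔.contactProl.dOne 𝓔.contactForm (γ.map q) (𝓔.evolutionSection H (γ.map q))
      (𝓔.graphMap γ q a) = 𝓔.data.dFun (H ∘ γ.map) q a := fun q a => by
    rw [𝓔.dOne_evolutionSection H (hγ.vanishes q a), 𝓔.prolDeriv_graphMap hH]
  refine ⟨fun hrel q => LinearMap.ext fun a => ?_, fun h0 q => ?_⟩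
  · rw [← h, hrel q, hγ.dOne_graphMap, LinearMap.zero_apply]
  · refine 𝓔.eq_graphMap hγ rfl (𝓔.contactForm_evolutionSection H _) fun a => ?_
    rw [h, h0, LinearMap.zero_apply]
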